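/- **Theorem 4.1.** Let $F$ be a continuous distribution function on $\mathbb{R}$ with $F(0)=0$ and $F(x)<F(y)$ for all $0\le x<y$, and let $r\ge 1$ be an integer and $a>0$. For two probability distributions $P,Q$ on $\mathbb{R}$ put $$d_1(P,Q)=d_{\mathrm{TV}}(P,Q)=\sup_{A}|P(A)-Q(A)|\quad(\text{supremum over Borel sets } A\subset\mathbb{R}),\qquad d_2(P,Q)=d_{\mathrm{loc}}(P,Q)=\sup_{x\in\mathbb{R}}|P([x,x+1))-Q([x,x+1))|,$$ and write $\widehat{\mathrm{Bi}}(m,q)$ for the binomial distribution $\mathrm{Bi}(m,q)$ shifted by $-mq$, and $\langle x\rangle=x-\lfloor x\rfloor$. Then there are constants $C_1,C_2$, depending only on $F$, $r$ and $a$, such that the following holds for every $n$. Let $X_1,\dots,X_{n+r-1}$ be independent random variables with distribution function $F$, let $R_i=\sum_{k=0}^{r-1}X_{i+k}$ for $1\le i\le n$, let $N^-=\#\{1\le i\le n: R_i\le a\}$, $p=\mathbb{P}[R_1\le a]$ and $\sigma^2=\operatorname{Var}N^-$. If $\sigma^2>1$, then, with $$\delta=\langle-4\sigma^2\rangle,\qquad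 t=\frac{\langle -np+2\sigma^2+\delta/2\rangle}{4\sigma^2+\delta},$$ one has $$d_l\big(\mathcal{L}(N^--np),\ \widehat{\mathrm{Bi}}(\lceil4\sigma^2\rceil,\tfrac12-t)\big)\le C_l\,n^{-l/2},\qquad l=1,2.$$ -/

import Mathlib

open MeasureTheory ProbabilityTheory

noncomputable section

/-- Total variation distance of two probability measures on the real line: the supremum of
`|P(A) - Q(A)|` over Borel sets `A`. -/
def dTV (P Q : Measure ℝ) : ℝ :=
  ⨆ A : {A : Set ℝ // MeasurableSet A}, |P.real A.1 - Q.real A.1|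

/-- Local limit metric: the supremum of `|P([x, x+1)) - Q([x, x+1))|` over real `x`. -/
def dLoc (P Q : Measure ℝ) : ℝ :=
  ⨆ x : ℝ, |P.real (Set.Ico x (x + 1)) - Q.real (Set.Ico x (x + 1))|

/-- The centered binomial distribution: the binomial distribution with `m` trials of success
probability `q`, shifted by its mean `m q`. -/
def centeredBinomial (m : ℕ) (q : unitInterval) : Measure ℝ :=
  (binomial m q).map (fun k : ℕ => (k : ℝ) - m * (q : ℝ))

/-- The rounding error `δ = ⟨-4σ²⟩`, where `⟨·⟩` is the fractional part; `s` stands for `σ²`. -/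
def roundingError (s : ℝ) : ℝ := Int.fract (-(4 * s))

/-- The parameter `t = ⟨b + 2σ² + δ/2⟩ / (4σ² + δ)` that shifts the centered binomial distribution
to the lattice `ℤ + b`; here `s` stands for `σ²`. -/
def latticeParam (b s : ℝ) : ℝ :=
  Int.fract (b + 2 * s + roundingError s / 2) / (4 * s + roundingError s)

/-- `1/2 - t` is a probability as soon as `σ² > 1`. -/
theorem half_sub_latticeParam_mem (b : ℝ) {s : ℝ} (hs : 1 < s) :
    1 / 2 - latticeParam b s ∈ unitInterval := by
  have hd : 0 ≤ roundingError s := Int.fract_nonneg _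
  have hpos : 0 < 4 * s + roundingError s := by linarith
  have hf := Int.fract_nonneg (b + 2 * s + roundingError s / 2)
  have hf1 := Int.fract_lt_one (b + 2 * s + roundingError s / 2)
  have h0 : 0 ≤ latticeParam b s := div_nonneg hf hpos.le
  have h1 : latticeParam b s ≤ 1 / 2 := by
    rw [latticeParam, div_le_iff₀ hpos]
    linarith
  exact ⟨by linarith, by linarith⟩

/-- The `r`-scan `R_i = X_i + X_{i+1} + ⋯ + X_{i+r-1}`. -/
def rScan {Ω : Type*} (X : ℕ → Ω → ℝ) (r i : ℕ) (ω : Ω) : ℝ :=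
  ∑ k ∈ Finset.range r, X (i + k) ω

/-- The number of indices `i ∈ {1, …, n}` with `R_i ≤ a`, as a real number. -/
def scanCount {Ω : Type*} (X : ℕ → Ω → ℝ) (r n : ℕ) (a : ℝ) (ω : Ω) : ℝ :=
  ∑ i ∈ Finset.Icc 1 n, Set.indicator {ω' | rScan X r i ω' ≤ a} (fun _ => (1 : ℝ)) ω

/-- The law of `N - n p`, where `N` is the number of `r`-scans among the first `n` that are at most
`a`, and `p` is the probability that the first `r`-scan is at most `a`. -/
def centeredScanLaw {Ω : Type*} [MeasurableSpace Ω] (P : Measure Ω) (X : ℕ → Ω → ℝ)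
    (r n : ℕ) (a : ℝ) : Measure ℝ :=
  P.map (fun ω => scanCount X r n a ω - n * P.real {ω' | rScan X r 1 ω' ≤ a})

/-- The approximating centered binomial distribution with `⌈4σ²⌉` trials of success probability
`1/2 - t`, for the lattice `ℤ + b` and the variance `s = σ² > 1`. -/
def approxBinomial (b : ℝ) {s : ℝ} (hs : 1 < s) : Measure ℝ :=
  centeredBinomial ⌈4 * s⌉₊ ⟨1 / 2 - latticeParam b s, half_sub_latticeParam_mem b hs⟩

end

/-! ### Averaging over one coordinate of an infinite product measure. -/

section ProductSpace

variable (μ : Measure ℝ) [IsProbabilityMeasure μ]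

/-! The method is Fourier-analytic. Let `W` be the centered count and `φ` its characteristic
function. Both `W` and the approximating binomial live on the lattice `ℤ + b` with `b = -np`, and
both characteristic functions nearly solve the Gaussian equation `φ' = -σ²θφ`. Their difference `ψ`
therefore nearly solves it as well, with `ψ 0 = 0`, and is small enough for Fourier inversion to
give both bounds.

Decay. Cut the coordinates into blocks of length `r + 1`. With a probability that is positive and
the same for every block, the leading coordinate of the block exceeds `a` and all coordinates after
the second are at most `a/(2r)`. The second coordinate then affects a single scan indicator, since
every other window containing it contains the large coordinate too, and that indicator is a
nondegenerate Bernoulli variable. Averaging over these free coordinates gives `|φ(θ)| ≤ exp(-cnθ²)`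
on `[-π, π]`. The bound survives, up to a constant, when the scans near one index are dropped and a
weight depending on the coordinates there is inserted (`norm_integral_mul_exp_scan_le`). Comparing
it with the Taylor expansion of `φ` at `0` also yields `σ² ≥ 2cn`.

Differential equation. Indicators at distance at least `r` are independent. A Stein-type expansion
of `E[ξᵢ exp(iθW)]` around index `i` (`norm_integral_scan_mul_exp_sub_le`) has main term `iθ E[ξᵢVᵢ]
φ(θ)`, where `Vᵢ` sums the centered indicators near `i`, and error `O(θ² exp(-cnθ²))`. The numbers
`E[ξᵢVᵢ]` add up to `σ²`, so summation gives the equation with error `O(nθ² exp(-cnθ²))`. The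
binomial has variance within `1` of `σ²` and satisfies an analogous estimate directly, at the cost
of an additional `|θ|`.

Comparison. An integrating factor bounds `ψ` by `n^{-1/2}` and `ψ'` by a constant, each times a
Gaussian of width `n^{-1/2}`. Inversion bounds each point mass difference by `O(1/n)`, which is the
local bound. Parseval for `ψ` and for `ψ'`, followed by Cauchy–Schwarz with weights `1 + (z +
b)²/n`, bounds the sum of the differences by `O(n^{-1/2})`, which is the total variation bound
(`exists_coeff_bounds`). -/

/-- Resampling a single coordinate preserves the product measure. -/
theorem measurePreserving_update_infinitePi (s : ℕ) :
    MeasurePreserving (fun p : (ℕ → ℝ) × ℝ => Function.update p.1 s p.2)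
      ((Measure.infinitePi fun _ : ℕ => μ).prod μ) (Measure.infinitePi fun _ : ℕ => μ) := by
  refine ⟨measurable_update', ?_⟩
  refine Measure.eq_infinitePi _ fun S t ht => ?_
  rw [Measure.map_apply measurable_update' (MeasurableSet.pi S.countable_toSet fun i _ => ht i)]
  by_cases hs : s ∈ S
  · have : (fun p : (ℕ → ℝ) × ℝ => Function.update p.1 s p.2) ⁻¹' (Set.pi S t)
        = (Set.pi (S.erase s : Finset ℕ) t) ×ˢ t s := by
      ext ⟨x, y⟩
      simp only [Set.mem_preimage, Set.mem_pi, Finset.mem_coe, Set.mem_prod, Finset.mem_erase]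
      constructor
      · intro h
        refine ⟨fun i hi => by simpa [hi.1] using h i hi.2, by simpa using h s hs⟩
      · rintro ⟨h1, h2⟩ i hi
        by_cases his : i = s
        · subst his; simpa using h2
        · simpa [his] using h1 i ⟨his, hi⟩
    rw [this, Measure.prod_prod, Measure.infinitePi_pi _ (fun i _ => ht i),
      Finset.prod_erase_mul _ _ hs]
  · have : (fun p : (ℕ → ℝ) × ℝ => Function.update p.1 s p.2) ⁻¹' (Set.pi S t)
        = (Set.pi S t) ×ˢ Set.univ := by
      ext ⟨x, y⟩
      simp only [Set.mem_preimage, Set.mem_pi, Finset.mem_coe, Set.mem_prod, Set.mem_univ, and_true]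
      refine forall₂_congr fun i hi => ?_
      have : i ≠ s := fun h => hs (h ▸ hi)
      simp [this]
    rw [this, Measure.prod_prod, Measure.infinitePi_pi _ (fun i _ => ht i)]
    simp

/-- The integral of a bounded function, computed by first averaging over one coordinate. -/
theorem integral_eq_integral_integral_update {H : (ℕ → ℝ) → ℂ} (hH : Measurable H) {M : ℝ}
    (hM : ∀ x, ‖H x‖ ≤ M) (s : ℕ) :
    ∫ x, H x ∂(Measure.infinitePi fun _ : ℕ => μ)
      = ∫ x, ∫ y, H (Function.update x s y) ∂μ ∂(Measure.infinitePi fun _ : ℕ => μ) := by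
  have h := measurePreserving_update_infinitePi μ s
  have hcomp : Measurable fun p : (ℕ → ℝ) × ℝ => H (Function.update p.1 s p.2) :=
    hH.comp measurable_update'
  rw [← h.map_eq, integral_map h.measurable.aemeasurable hH.aestronglyMeasurable,
    h.map_eq, integral_prod]
  exact Integrable.of_bound hcomp.aestronglyMeasurable M (Filter.Eventually.of_forall fun p => hM _)

/-- Functions of disjoint sets of coordinates are uncorrelated under the product measure. -/
theorem integral_mul_of_dependsOn {𝕜 : Type*} [RCLike 𝕜] {f g : (ℕ → ℝ) → 𝕜} (hf : Measurable f) (hg : Measurable g)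
    {S T : Finset ℕ} (hST : Disjoint S T) (hfS : DependsOn f S) (hgT : DependsOn g T) :
    ∫ x, f x * g x ∂(Measure.infinitePi fun _ : ℕ => μ)
      = (∫ x, f x ∂(Measure.infinitePi fun _ : ℕ => μ))
        * ∫ x, g x ∂(Measure.infinitePi fun _ : ℕ => μ) := by
  have hind : iIndepFun (fun (i : ℕ) (x : ℕ → ℝ) => x i) (Measure.infinitePi fun _ : ℕ => μ) :=
    iIndepFun_infinitePi (P := fun _ : ℕ => μ) (X := fun _ y => y) (fun _ => measurable_id)
  have h2 := hind.indepFun_finset S T hST (fun i => measurable_pi_apply i)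
  have key : ∀ (U : Finset ℕ) (F : (ℕ → ℝ) → 𝕜), Measurable F → DependsOn F U →
      ∃ F' : (U → ℝ) → 𝕜, Measurable F' ∧ F = F' ∘ fun a (i : U) => a i := by
    intro U F hF hFU
    refine ⟨fun z => F (fun i => if h : i ∈ U then z ⟨i, h⟩ else 0), hF.comp ?_, ?_⟩
    · refine measurable_pi_iff.2 fun i => ?_
      by_cases h : i ∈ U
      · simp only [h, dite_true]; exact measurable_pi_apply _
      · simp only [h, dite_false]; exact measurable_const
    · funext x
      refine hFU fun i hi => ?_
      have : i ∈ U := hi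
      simp [this]
  obtain ⟨f', hf', rfl⟩ := key S f hf hfS
  obtain ⟨g', hg', rfl⟩ := key T g hg hgT
  exact (h2.comp hf' hg').integral_fun_mul_eq_mul_integral hf.aestronglyMeasurable
    hg.aestronglyMeasurable

/-- Averaging successively over the coordinates `s q`, each of which contributes an independent
phase `u q` on the event `G q`, contracts the modulus of an integral. -/
theorem norm_integral_le_integral_prod (s : ℕ → ℕ) (u : ℕ → (ℕ → ℝ) → ℂ) (G : ℕ → Set (ℕ → ℝ))
    (hu1 : ∀ q x, ‖u q x‖ = 1) (hGm : ∀ q, MeasurableSet (G q))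
    {κ : ℝ} (hκ0 : 0 ≤ κ) (hκ1 : κ ≤ 1)
    (huG : ∀ q, ∀ x ∈ G q, ‖∫ y, u q (Function.update x (s q) y) ∂μ‖ ≤ 1 - κ)
    (B : Finset ℕ)
    (hG : ∀ q ∈ B, ∀ q' ∈ B, ∀ x y, Function.update x (s q') y ∈ G q ↔ x ∈ G q)
    (huB : ∀ q ∈ B, ∀ q' ∈ B, q ≠ q' → ∀ x y, u q (Function.update x (s q') y) = u q x)
    (hs : Set.InjOn s B)
    (H : (ℕ → ℝ) → ℂ) (β : (ℕ → ℝ) → ℝ) (hH : Measurable H) (hβ : Measurable β) (M : ℝ)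
    (hHβ : ∀ x, ‖H x‖ ≤ β x) (hβM : ∀ x, β x ≤ M)
    (hβB : ∀ q ∈ B, ∀ x y, β (Function.update x (s q) y) = β x)
    (hHu : ∀ q ∈ B, ∀ x ∈ G q, ∀ y,
      H (Function.update x (s q) y) * u q x = H x * u q (Function.update x (s q) y)) :
    ‖∫ x, H x ∂(Measure.infinitePi fun _ : ℕ => μ)‖
      ≤ ∫ x, β x * ∏ q ∈ B, (1 - (G q).indicator (fun _ => κ) x)
          ∂(Measure.infinitePi fun _ : ℕ => μ) := by
  -- Integrating out one coordinate replaces `H` by its partial average and `β` by `β` times the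
  -- contraction factor of that block, so both must vary in the induction.
  induction B using Finset.induction_on generalizing H β with
  | empty =>
    simp only [Finset.prod_empty, mul_one]
    refine (norm_integral_le_integral_norm _).trans ?_
    have hβ0 : ∀ x, 0 ≤ β x := fun x => (norm_nonneg _).trans (hHβ x)
    refine integral_mono_of_nonneg (Filter.Eventually.of_forall fun x => norm_nonneg _) ?_
      (Filter.Eventually.of_forall hHβ)
    refine Integrable.of_bound hβ.aestronglyMeasurable M (Filter.Eventually.of_forall fun x => ?_)
    rw [Real.norm_of_nonneg (hβ0 x)]; exact hβM x
  | insert q B hq ih =>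
    have hβ0 : ∀ x, 0 ≤ β x := fun x => (norm_nonneg _).trans (hHβ x)
    have hqm : q ∈ insert q B := Finset.mem_insert_self _ _
    have hsub : ∀ q' ∈ B, q' ∈ insert q B := fun q' h => Finset.mem_insert_of_mem h
    have hupd : Measurable fun p : (ℕ → ℝ) × ℝ => H (Function.update p.1 (s q) p.2) :=
      hH.comp measurable_update'
    set A : (ℕ → ℝ) → ℂ := fun x => ∫ y, H (Function.update x (s q) y) ∂μ with hA
    have hAm : Measurable A := by
      have := hupd.stronglyMeasurable.integral_prod_right' (ν := μ)
      exact this.measurable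
    set b : (ℕ → ℝ) → ℝ := fun x => 1 - (G q).indicator (fun _ => κ) x with hb
    have hbm : Measurable b := measurable_const.sub (measurable_const.indicator (hGm q))
    have hb0 : ∀ x, 0 ≤ b x ∧ b x ≤ 1 := by
      intro x
      by_cases hx : x ∈ G q <;> simp [hb, hx, hκ0, hκ1]
    rw [integral_eq_integral_integral_update μ hH (fun x => (hHβ x).trans (hβM x)) (s q)]
    have := ih (fun p hp p' hp' => hG p (hsub p hp) p' (hsub p' hp'))
      (fun p hp p' hp' => huB p (hsub p hp) p' (hsub p' hp'))
      (hs.mono (by simp)) A (fun x => β x * b x) hAm (hβ.mul hbm) ?_ ?_ ?_ ?_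
    · refine this.trans (le_of_eq ?_)
      congr 1
      funext x
      rw [Finset.prod_insert hq]
      simp only [hb]; ring
    · intro x
      by_cases hx : x ∈ G q
      -- On `G q` the resampled coordinate enters `H` only through the phase `u q`. Since the phase
      -- has modulus one, cross-multiplication replaces division.
      · have h1 : A x * u q x = H x * ∫ y, u q (Function.update x (s q) y) ∂μ := by
          simp only [hA]
          rw [← integral_mul_const, ← integral_const_mul]
          exact integral_congr_ae (Filter.Eventually.of_forall fun y => hHu q hqm x hx y)
        have h2 : ‖A x‖ = ‖H x‖ * ‖∫ y, u q (Function.update x (s q) y) ∂μ‖ := by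
          have := congrArg norm h1
          rwa [norm_mul, norm_mul, hu1, mul_one] at this
        rw [h2]
        have : b x = 1 - κ := by simp [hb, hx]
        rw [this]
        exact mul_le_mul (hHβ x) (huG q x hx) (norm_nonneg _) (hβ0 x)
      · have : b x = 1 := by simp [hb, hx]
        rw [this, mul_one]
        calc ‖A x‖ ≤ ∫ y, ‖H (Function.update x (s q) y)‖ ∂μ := norm_integral_le_integral_norm _
          _ ≤ ∫ _, β x ∂μ := by
            refine integral_mono_of_nonneg (Filter.Eventually.of_forall fun y => norm_nonneg _)
              (integrable_const _) (Filter.Eventually.of_forall fun y => ?_)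
            exact (hHβ _).trans (hβB q hqm x y).le
          _ = β x := by simp
    · intro x
      exact (mul_le_of_le_one_right (hβ0 x) (hb0 x).2).trans (hβM x)
    · intro p hp x y
      have h1 := hG q hqm p (hsub p hp) x y
      have h2 : b (Function.update x (s p) y) = b x := by
        by_cases hx : x ∈ G q
        · simp [hb, hx, h1.2 hx]
        · have : Function.update x (s p) y ∉ G q := fun h => hx (h1.1 h)
          simp [hb, hx, this]
      rw [hβB p (hsub p hp), h2]
    · intro p hp x hx y
      have hne : p ≠ q := fun h => hq (h ▸ hp)
      have hsne : s p ≠ s q := fun h => hne (hs (hsub p hp) hqm h)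
      simp only [hA]
      rw [← integral_mul_const, ← integral_mul_const]
      refine integral_congr_ae (Filter.Eventually.of_forall fun z => ?_)
      have h1 := hHu p (hsub p hp) (Function.update x (s q) z)
        ((hG p (hsub p hp) q hqm x z).2 hx) y
      simp only
      rw [Function.update_comm hsne]
      rw [huB p (hsub p hp) q hqm hne] at h1
      rw [h1, Function.update_comm hsne.symm, huB p (hsub p hp) q hqm hne]

end ProductSpace

/-! ### Free coordinates in blocks and contraction of the characteristic function. -/

section Scan

/-- The indicator that the `i`-th `r`-scan of the positive parts of a real sequence is at most
`a`. -/
noncomputable def lowScan (r : ℕ) (a : ℝ) (i : ℕ) (x : ℕ → ℝ) : ℝ :=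
  Set.indicator {x | rScan (fun (j : ℕ) (x : ℕ → ℝ) => max (x j) 0) r i x ≤ a} (fun _ => (1 : ℝ)) x

theorem measurable_rScan_max (r i : ℕ) :
    Measurable (rScan (fun (j : ℕ) (x : ℕ → ℝ) => max (x j) 0) r i) := by
  unfold rScan
  fun_prop

theorem measurable_lowScan (r : ℕ) (a : ℝ) (i : ℕ) : Measurable (lowScan r a i) :=
  measurable_const.indicator (measurableSet_le (measurable_rScan_max r i) measurable_const)

theorem lowScan_nonneg (r : ℕ) (a : ℝ) (i : ℕ) (x : ℕ → ℝ) : 0 ≤ lowScan r a i x :=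
  Set.indicator_nonneg (fun _ _ => zero_le_one) _

theorem lowScan_le_one (r : ℕ) (a : ℝ) (i : ℕ) (x : ℕ → ℝ) : lowScan r a i x ≤ 1 :=
  Set.indicator_le_self' (fun _ _ => zero_le_one) _

theorem dependsOn_lowScan (r : ℕ) (a : ℝ) (i : ℕ) :
    DependsOn (lowScan r a i) (Finset.Ico i (i + r)) := by
  intro x y h
  have : rScan (fun (j : ℕ) (x : ℕ → ℝ) => max (x j) 0) r i x
      = rScan (fun (j : ℕ) (x : ℕ → ℝ) => max (x j) 0) r i y := by
    unfold rScan
    refine Finset.sum_congr rfl fun k hk => ?_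
    have := h (i + k) (by simpa using hk)
    simp only [this]
  simp [lowScan, Set.indicator_apply, this]

theorem lowScan_update_of_notMem {r : ℕ} {a : ℝ} {i s : ℕ} (h : ¬ (i ≤ s ∧ s < i + r))
    (x : ℕ → ℝ) (y : ℝ) : lowScan r a i (Function.update x s y) = lowScan r a i x := by
  refine dependsOn_lowScan r a i fun j hj => ?_
  have : j ≠ s := by
    rintro rfl
    exact h (by simpa using hj)
  simp [this]

/-- Taking positive parts makes this hold pointwise: no other term can compensate one coordinate
above `a`. -/
theorem lowScan_eq_zero {r : ℕ} {a : ℝ} {i j : ℕ} (hij : i ≤ j) (hj : j < i + r) {x : ℕ → ℝ}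
    (hx : a < x j) : lowScan r a i x = 0 := by
  refine Set.indicator_of_notMem ?_ _
  simp only [Set.mem_ofPred_eq, not_le, rScan]
  refine hx.trans_le ((le_max_left _ 0).trans ?_)
  have := Finset.single_le_sum (f := fun k => max (x (i + k)) 0) (s := Finset.range r)
    (fun k _ => le_max_right _ _) (Finset.mem_range.2 (show j - i < r by omega))
  simpa [Nat.add_sub_cancel' hij] using this

/-- The ranges of the variables around a free coordinate (at position `1`) which force it to
influence just one scan. -/
def blockSet (r : ℕ) (a : ℝ) : ℕ → Set ℝ
  | 0 => Set.Ioi a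
  | 1 => Set.univ
  | _ + 2 => Set.Iic (a / (2 * r))

theorem measurableSet_blockSet (r : ℕ) (a : ℝ) (i : ℕ) : MeasurableSet (blockSet r a i) := by
  rcases i with _ | _ | i
  · exact measurableSet_Ioi
  · exact MeasurableSet.univ
  · exact measurableSet_Iic

/-- In the `q`-th block of `r + 1` coordinates, the second coordinate influences just one scan. -/
def blockEvent (r : ℕ) (a : ℝ) (q : ℕ) : Set (ℕ → ℝ) :=
  {x | ∀ i ∈ Finset.range (r + 1), x ((r + 1) * q + i) ∈ blockSet r a i}

theorem measurableSet_blockEvent (r : ℕ) (a : ℝ) (q : ℕ) : MeasurableSet (blockEvent r a q) := by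
  have : blockEvent r a q = ⋂ i ∈ Finset.range (r + 1),
      (fun x : ℕ → ℝ => x ((r + 1) * q + i)) ⁻¹' blockSet r a i := by
    ext x; simp [blockEvent]
  rw [this]
  exact Finset.measurableSet_biInter _ fun i _ =>
    measurable_pi_apply _ (measurableSet_blockSet r a i)

variable (μ : Measure ℝ) [IsProbabilityMeasure μ]

theorem measureReal_blockEvent (r : ℕ) (a : ℝ) (q : ℕ) :
    (Measure.infinitePi fun _ : ℕ => μ).real (blockEvent r a q)
      = ∏ i ∈ Finset.range (r + 1), μ.real (blockSet r a i) := by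
  have : blockEvent r a q = Set.pi (Finset.Ico ((r + 1) * q) ((r + 1) * q + (r + 1)) : Finset ℕ)
      fun j => blockSet r a (j - (r + 1) * q) := by
    ext x
    simp only [blockEvent, Set.mem_ofPred_eq, Finset.mem_range, Set.mem_pi, Finset.mem_coe,
      Finset.mem_Ico]
    constructor
    · intro h j hj
      have := h (j - (r + 1) * q) (by omega)
      rwa [Nat.add_sub_cancel' hj.1] at this
    · intro h i hi
      have := h ((r + 1) * q + i) ⟨by omega, by omega⟩
      rwa [Nat.add_sub_cancel_left] at this
  rw [this, measureReal_def, Measure.infinitePi_pi _ fun i _ => measurableSet_blockSet r a _,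
    ENNReal.toReal_prod, Finset.prod_Ico_eq_prod_range]
  simp [measureReal_def]

/-- Position `1` of a block is unconstrained, so resampling free coordinates never changes which
block events occur. -/
theorem blockEvent_congr {r : ℕ} {a : ℝ} {q : ℕ} {x y : ℕ → ℝ}
    (h : ∀ j, (r + 1) * q ≤ j → j < (r + 1) * q + (r + 1) → j ≠ (r + 1) * q + 1 → x j = y j) :
    x ∈ blockEvent r a q ↔ y ∈ blockEvent r a q := by
  simp only [blockEvent, Set.mem_ofPred_eq, Finset.mem_range]
  refine forall₂_congr fun i hi => ?_
  by_cases h1 : i = 1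
  · subst h1; simp [blockSet]
  · rw [h _ (by omega) (by omega) (by omega)]

/-- Here `π` is a success probability, not the circle constant. The squared modulus equals `1 -
2π(1-π)(1 - cos θ)`, and `1 - 2w ≤ (1 - w)²`. -/
theorem norm_one_add_mul_exp_sub_one_le {π θ : ℝ} (h0 : 0 ≤ π) (h1 : π ≤ 1) :
    ‖1 + (π : ℂ) * (Complex.exp (θ * Complex.I) - 1)‖ ≤ 1 - π * (1 - π) * (1 - Real.cos θ) := by
  have hc := Real.cos_le_one θ
  have hc' := Real.neg_one_le_cos θ
  have hp : π * (1 - π) ≤ 1 / 4 := by nlinarith [sq_nonneg (π - 1 / 2)]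
  have hp0 : 0 ≤ π * (1 - π) := mul_nonneg h0 (by linarith)
  have hnn : 0 ≤ 1 - π * (1 - π) * (1 - Real.cos θ) := by nlinarith
  refine le_of_sq_le_sq ?_ hnn
  rw [← Complex.normSq_eq_norm_sq, Complex.normSq_apply]
  simp only [Complex.add_re, Complex.one_re, Complex.mul_re, Complex.ofReal_re, Complex.sub_re,
    Complex.exp_ofReal_mul_I_re, Complex.ofReal_im, Complex.sub_im, Complex.exp_ofReal_mul_I_im,
    Complex.one_im, Complex.add_im, Complex.mul_im]
  have hs := Real.sin_sq_add_cos_sq θ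
  have : (1 + (π * (Real.cos θ - 1) - 0 * (Real.sin θ - 0))) * (1 + (π * (Real.cos θ - 1) - 0 * (Real.sin θ - 0))) + (0 + (π * (Real.sin θ - 0) + 0 * (Real.cos θ - 1))) * (0 + (π * (Real.sin θ - 0) + 0 * (Real.cos θ - 1))) = 1 - 2 * (π * (1 - π)) * (1 - Real.cos θ) := by
    linear_combination π ^ 2 * hs
  rw [this]
  nlinarith [sq_nonneg (π * (1 - π) * (1 - Real.cos θ))]

/-- On the block event, averaging over the free coordinate contracts the phase of its scan. -/
theorem norm_integral_exp_lowScan_le {r : ℕ} (hr : 1 ≤ r) {a : ℝ} (ha : 0 < a) (θ : ℝ) {q : ℕ}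
    {x : ℕ → ℝ} (hx : x ∈ blockEvent r a q) :
    ‖∫ y, Complex.exp ((θ * lowScan r a ((r + 1) * q + 1)
        (Function.update x ((r + 1) * q + 1) y) : ℝ) * Complex.I) ∂μ‖
      ≤ 1 - μ.real (Set.Iic (a / 2)) * μ.real (Set.Ioi a) * (1 - Real.cos θ) := by
  obtain ⟨r, rfl⟩ : ∃ k, r = k + 1 := ⟨r - 1, by omega⟩
  set s := (r + 1 + 1) * q + 1 with hs
  set S := ∑ k ∈ Finset.range r, max (x (s + (k + 1))) 0 with hS
  have hS0 : 0 ≤ S := Finset.sum_nonneg fun k _ => le_max_right _ _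
  -- The window now has length `r + 1`: besides the free coordinate it has `r` coordinates, each at
  -- most `a / (2(r+1))`. Hence the indicator is surely `1` when the free coordinate is at most
  -- `a/2`, and surely `0` when it exceeds `a`.
  have hSa : S ≤ a / 2 := by
    have : ∀ k ∈ Finset.range r, max (x (s + (k + 1))) 0 ≤ a / (2 * (r + 1 : ℕ)) := by
      intro k hk
      have := hx (k + 2) (by simp at hk ⊢; omega)
      have e : (r + 1 + 1) * q + (k + 2) = s + (k + 1) := by omega
      rw [e] at this
      exact max_le this (by positivity)
    refine (Finset.sum_le_sum this).trans ?_
    rw [Finset.sum_const, Finset.card_range, nsmul_eq_mul, ← mul_div_assoc,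
      div_le_div_iff₀ (by positivity) (by norm_num)]
    push_cast
    nlinarith
  set D : Set ℝ := {y | max y 0 + S ≤ a} with hD
  have hDm : MeasurableSet D :=
    measurableSet_le ((measurable_id.max measurable_const).add_const S) measurable_const
  have hlow : ∀ y, lowScan (r + 1) a s (Function.update x s y) = D.indicator (fun _ => 1) y := by
    intro y
    have : rScan (fun (j : ℕ) (x : ℕ → ℝ) => max (x j) 0) (r + 1) s (Function.update x s y)
        = max y 0 + S := by
      rw [rScan, Finset.sum_range_succ', add_comm]
      simp [hS]
    simp only [lowScan, Set.indicator_apply, Set.mem_ofPred_eq, this, hD]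
  have hint : ∫ y, Complex.exp ((θ * lowScan (r + 1) a s (Function.update x s y) : ℝ) * Complex.I) ∂μ
      = 1 + (μ.real D : ℂ) * (Complex.exp (θ * Complex.I) - 1) := by
    have : ∀ y, Complex.exp ((θ * lowScan (r + 1) a s (Function.update x s y) : ℝ) * Complex.I)
        = 1 + D.indicator (fun _ => Complex.exp (θ * Complex.I) - 1) y := by
      intro y
      rw [hlow]
      by_cases hy : y ∈ D <;> simp [hy]
    simp_rw [this]
    rw [integral_add (integrable_const _) ((integrable_const _).indicator hDm),
      integral_indicator_const _ hDm]
    simp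
  rw [hint]
  refine (norm_one_add_mul_exp_sub_one_le measureReal_nonneg measureReal_le_one).trans ?_
  have h1 : μ.real (Set.Iic (a / 2)) ≤ μ.real D := by
    refine measureReal_mono fun y hy => ?_
    have : max y 0 ≤ a / 2 := max_le hy (by positivity)
    simp only [hD, Set.mem_ofPred_eq]; linarith
  have h2 : μ.real (Set.Ioi a) ≤ 1 - μ.real D := by
    rw [← probReal_compl_eq_one_sub hDm]
    refine measureReal_mono fun y hy => ?_
    simp only [hD, Set.mem_compl_iff, Set.mem_ofPred_eq, not_le]
    exact lt_of_lt_of_le hy (by linarith [le_max_left y 0])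
  have hc := Real.cos_le_one θ
  have : μ.real (Set.Iic (a / 2)) * μ.real (Set.Ioi a) ≤ μ.real D * (1 - μ.real D) :=
    mul_le_mul h1 h2 measureReal_nonneg measureReal_nonneg
  nlinarith

/-- Distinct blocks use disjoint coordinates, so the factors are independent with a common mean. -/
theorem integral_prod_blockEvent (r : ℕ) (a κ : ℝ) (B : Finset ℕ) :
    ∫ x, ∏ q ∈ B, (1 - (blockEvent r a q).indicator (fun _ => κ) x)
        ∂(Measure.infinitePi fun _ : ℕ => μ)
      = (1 - κ * ∏ i ∈ Finset.range (r + 1), μ.real (blockSet r a i)) ^ B.card := by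
  have hm : ∀ q, Measurable fun x => 1 - (blockEvent r a q).indicator (fun _ => κ) x := fun q =>
    measurable_const.sub (measurable_const.indicator (measurableSet_blockEvent r a q))
  have hdep : ∀ q, DependsOn (fun x => 1 - (blockEvent r a q).indicator (fun _ => κ) x)
      (Finset.Ico ((r + 1) * q) ((r + 1) * q + (r + 1))) := by
    intro q x y h
    have := blockEvent_congr (r := r) (a := a) (q := q) (fun j h1 h2 _ => h j (by simp [h1, h2]))
    by_cases hx : x ∈ blockEvent r a q
    · simp [hx, this.1 hx]
    · simp [hx, mt this.2 hx]
  induction B using Finset.induction_on with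
  | empty => simp
  | insert q B hq ih =>
    simp_rw [Finset.prod_insert hq]
    rw [integral_mul_of_dependsOn μ (hm q)
      (Finset.measurable_prod B fun i _ => hm i)
      (S := Finset.Ico ((r + 1) * q) ((r + 1) * q + (r + 1)))
      (T := B.biUnion fun q => Finset.Ico ((r + 1) * q) ((r + 1) * q + (r + 1))) ?_ (hdep q) ?_, ih,
      Finset.card_insert_of_notMem hq, pow_succ']
    · congr 1
      rw [integral_sub (integrable_const _)
        ((integrable_const _).indicator (measurableSet_blockEvent r a q)),
        integral_indicator_const _ (measurableSet_blockEvent r a q), measureReal_blockEvent]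
      simp [mul_comm]
    · rw [Finset.disjoint_left]
      intro j hj hj'
      simp only [Finset.mem_biUnion, Finset.mem_Ico] at hj hj'
      obtain ⟨p, hp, hp1, hp2⟩ := hj'
      have hne : q ≠ p := fun h => hq (h ▸ hp)
      rcases lt_or_gt_of_ne hne with h | h
      · have := Nat.mul_le_mul_left (r + 1) (Nat.succ_le_of_lt h)
        rw [Nat.succ_eq_add_one, mul_add] at this
        omega
      · have := Nat.mul_le_mul_left (r + 1) (Nat.succ_le_of_lt h)
        rw [Nat.succ_eq_add_one, mul_add] at this
        omega
    · intro x y h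
      refine Finset.prod_congr rfl fun p hp => hdep p fun j hj => h j ?_
      simp only [Finset.coe_biUnion, Set.mem_iUnion]
      exact ⟨p, hp, hj⟩

/-- The two half-lines are disjoint, so their masses add up to at most `1`. This keeps the
contraction `κ`, which carries a factor `1 - cos θ ≤ 2`, below `1`. -/
theorem measureReal_Iic_mul_Ioi_le {a : ℝ} (ha : 0 < a) :
    μ.real (Set.Iic (a / 2)) * μ.real (Set.Ioi a) ≤ 1 / 4 := by
  have h1 : μ.real (Set.Iic (a / 2)) ≤ 1 - μ.real (Set.Ioi a) := by
    rw [← probReal_compl_eq_one_sub measurableSet_Ioi]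
    refine measureReal_mono fun y hy => ?_
    simp only [Set.mem_Iic, Set.compl_Ioi] at *
    linarith
  have h3 : (0 : ℝ) ≤ μ.real (Set.Ioi a) := measureReal_nonneg
  nlinarith [sq_nonneg (μ.real (Set.Ioi a) - 1 / 2)]

/-- Decay of the characteristic function of a sum of scan indicators, weighted by a function of
finitely many coordinates, in terms of the number of blocks avoiding these coordinates. -/
theorem norm_integral_mul_exp_le_pow {r : ℕ} (hr : 1 ≤ r) {a : ℝ} (ha : 0 < a) (θ p : ℝ)
    (T L B : Finset ℕ) (hBT : ∀ q ∈ B, (r + 1) * q + 1 ∈ T)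
    (hBL : ∀ q ∈ B, (r + 1) * q + 1 ∉ L)
    {ζ : (ℕ → ℝ) → ℂ} (hζ : Measurable ζ) (hζL : DependsOn ζ L) {M : ℝ} (hM : ∀ x, ‖ζ x‖ ≤ M) :
    ‖∫ x, ζ x * Complex.exp ((θ * ∑ k ∈ T, (lowScan r a k x - p) : ℝ) * Complex.I)
        ∂(Measure.infinitePi fun _ : ℕ => μ)‖
      ≤ M * (1 - μ.real (Set.Iic (a / 2)) * μ.real (Set.Ioi a) * (1 - Real.cos θ)
          * ∏ i ∈ Finset.range (r + 1), μ.real (blockSet r a i)) ^ B.card := by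
  set κ := μ.real (Set.Iic (a / 2)) * μ.real (Set.Ioi a) * (1 - Real.cos θ) with hκ
  have hκ0 : 0 ≤ κ := mul_nonneg (mul_nonneg measureReal_nonneg measureReal_nonneg)
    (by linarith [Real.cos_le_one θ])
  have hκ1 : κ ≤ 1 := by
    have h2 : (0 : ℝ) ≤ μ.real (Set.Iic (a / 2)) := measureReal_nonneg
    have h3 : (0 : ℝ) ≤ μ.real (Set.Ioi a) := measureReal_nonneg
    have h4 := measureReal_Iic_mul_Ioi_le μ ha
    have := Real.neg_one_le_cos θ
    have := Real.cos_le_one θ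
    have := mul_nonneg h2 h3
    nlinarith
  have hsep : ∀ q q', q ≠ q' → ((r + 1) * q + (r + 1) ≤ (r + 1) * q') ∨
      ((r + 1) * q' + (r + 1) ≤ (r + 1) * q) := by
    intro q q' hne
    rcases lt_or_gt_of_ne hne with h | h
    · left
      simpa [mul_add] using Nat.mul_le_mul_left (r + 1) (Nat.succ_le_of_lt h)
    · right
      simpa [mul_add] using Nat.mul_le_mul_left (r + 1) (Nat.succ_le_of_lt h)
  have hsm : Measurable fun x : ℕ → ℝ => ∑ k ∈ T, (lowScan r a k x - p) :=
    Finset.measurable_sum _ fun k _ => (measurable_lowScan r a k).sub_const p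
  have := norm_integral_le_integral_prod μ (fun q => (r + 1) * q + 1)
    (fun q x => Complex.exp ((θ * lowScan r a ((r + 1) * q + 1) x : ℝ) * Complex.I))
    (blockEvent r a) (fun q x => Complex.norm_exp_ofReal_mul_I _)
    (measurableSet_blockEvent r a) hκ0 hκ1
    (fun q x hx => norm_integral_exp_lowScan_le μ hr ha θ hx) B ?_ ?_ ?_
    (fun x => ζ x * Complex.exp ((θ * ∑ k ∈ T, (lowScan r a k x - p) : ℝ) * Complex.I))
    (fun _ => M) (hζ.mul (by fun_prop)) measurable_const M ?_ (fun _ => le_rfl)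
    (fun _ _ _ _ => rfl) ?_
  · refine this.trans (le_of_eq ?_)
    rw [integral_const_mul, integral_prod_blockEvent]
  · intro q _ q' _ x y
    refine blockEvent_congr fun j h1 h2 h3 => ?_
    have : j ≠ (r + 1) * q' + 1 := by
      rintro rfl
      by_cases hqq : q = q'
      · subst hqq; exact h3 rfl
      · rcases hsep q q' hqq with h | h <;> omega
    simp [this]
  · intro q _ q' _ hne x y
    rw [lowScan_update_of_notMem]
    rcases hsep q q' hne with h | h <;> omega
  · intro q _ q' _ h
    have : (r + 1) * q + 1 = (r + 1) * q' + 1 := h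
    exact Nat.eq_of_mul_eq_mul_left (Nat.succ_pos r) (Nat.succ_injective this)
  · intro x
    rw [norm_mul, Complex.norm_exp_ofReal_mul_I, mul_one]
    exact hM x
  · intro q hq x hx y
    set s := (r + 1) * q + 1 with hs
    have h1 : ζ (Function.update x s y) = ζ x := by
      refine hζL fun j hj => ?_
      have : j ≠ s := by
        rintro rfl
        exact hBL q hq hj
      simp [this]
    have h2 : ∑ k ∈ T.erase s, (lowScan r a k (Function.update x s y) - p)
        = ∑ k ∈ T.erase s, (lowScan r a k x - p) := by
      refine Finset.sum_congr rfl fun k hk => ?_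
      have hks : k ≠ s := Finset.ne_of_mem_erase hk
      -- A window other than `s` that contains the free coordinate starts before it, hence also
      -- contains the leading coordinate of the block. That coordinate exceeds `a`, and the
      -- indicator vanishes before and after resampling.
      by_cases hcase : k ≤ s ∧ s < k + r
      · have hxs : a < x ((r + 1) * q) := hx 0 (by simp)
        have hne : (r + 1) * q ≠ s := by omega
        rw [lowScan_eq_zero (j := (r + 1) * q) (by omega) (by omega) hxs,
          lowScan_eq_zero (j := (r + 1) * q) (by omega) (by omega) (by simpa [hne] using hxs)]
      · rw [lowScan_update_of_notMem hcase]
    rw [h1, ← Finset.add_sum_erase T _ (hBT q hq), ← Finset.add_sum_erase T _ (hBT q hq), h2,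
      mul_assoc, mul_assoc, ← Complex.exp_add, ← Complex.exp_add]
    congr 2
    push_cast
    ring

end Scan

/-! ### Gaussian decay of the characteristic function. -/

section Decay

variable (μ : Measure ℝ) [IsProbabilityMeasure μ]

/-- The rate of Gaussian decay of the characteristic function of the scan count. -/
noncomputable def decayRate (r : ℕ) (a : ℝ) : ℝ :=
  μ.real (Set.Iic (a / 2)) * μ.real (Set.Ioi a) * (2 / Real.pi ^ 2)
    * (∏ i ∈ Finset.range (r + 1), μ.real (blockSet r a i)) / (r + 1)

theorem decayRate_pos {r : ℕ} (hr : 1 ≤ r) {a : ℝ} (ha : 0 < a)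
    (hlow : ∀ x, 0 < x → 0 < μ.real (Set.Iic x)) (hhigh : 0 < μ.real (Set.Ioi a)) :
    0 < decayRate μ r a := by
  have h1 : 0 < ∏ i ∈ Finset.range (r + 1), μ.real (blockSet r a i) := by
    refine Finset.prod_pos fun i _ => ?_
    have hr' : (0 : ℝ) < r := by exact_mod_cast hr
    rcases i with _ | _ | i
    · exact hhigh
    · simp [blockSet]
    · exact hlow _ (by positivity)
  have h2 := hlow (a / 2) (by positivity)
  have := Real.pi_pos
  unfold decayRate
  positivity

/-- `K` is the number of blocks that are missing. Each costs at most a factor `e`, since one block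
contributes at most `1` to the exponent, so `exp (2K)` is ample. The quadratic rate comes from `1 -
cos θ ≥ 2θ²/π²` on `[-π, π]`. -/
theorem pow_card_le_exp {r : ℕ} {a θ : ℝ} (ha : 0 < a) (hθ : |θ| ≤ Real.pi) {m n K : ℕ}
    (hm : n ≤ (r + 1) * (m + K)) :
    (1 - μ.real (Set.Iic (a / 2)) * μ.real (Set.Ioi a) * (1 - Real.cos θ)
          * ∏ i ∈ Finset.range (r + 1), μ.real (blockSet r a i)) ^ m
      ≤ Real.exp (2 * K) * Real.exp (-(decayRate μ r a * n * θ ^ 2)) := by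
  have hα0 : (0 : ℝ) ≤ μ.real (Set.Iic (a / 2)) := measureReal_nonneg
  have hα1 : μ.real (Set.Iic (a / 2)) ≤ 1 := measureReal_le_one
  have hβ0 : (0 : ℝ) ≤ μ.real (Set.Ioi a) := measureReal_nonneg
  have hβ1 : μ.real (Set.Ioi a) ≤ 1 := measureReal_le_one
  have hc := Real.cos_le_one θ
  have hc' := Real.neg_one_le_cos θ
  set g := ∏ i ∈ Finset.range (r + 1), μ.real (blockSet r a i) with hg
  have hg0 : 0 ≤ g := Finset.prod_nonneg fun i _ => measureReal_nonneg
  have hg1 : g ≤ 1 := Finset.prod_le_one (fun i _ => measureReal_nonneg)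
    fun i _ => measureReal_le_one
  set w := μ.real (Set.Iic (a / 2)) * μ.real (Set.Ioi a) with hw
  have hw0 : 0 ≤ w := mul_nonneg hα0 hβ0
  have hw1 : w ≤ 1 := mul_le_one₀ hα1 hβ0 hβ1
  have hα' : w ≤ 1 / 4 := measureReal_Iic_mul_Ioi_le μ ha
  have hwc0 : 0 ≤ w * (1 - Real.cos θ) := mul_nonneg hw0 (by linarith)
  have hwc1 : w * (1 - Real.cos θ) ≤ 1 := by nlinarith
  set v := w * (1 - Real.cos θ) * g with hv
  have hv0 : 0 ≤ v := mul_nonneg hwc0 hg0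
  have hv1 : v ≤ 1 := mul_le_one₀ hwc1 hg0 hg1
  have hmn : (n : ℝ) / (r + 1) ≤ m + K := by
    rw [div_le_iff₀ (by positivity)]
    have : ((n : ℕ) : ℝ) ≤ ((r + 1) * (m + K) : ℕ) := by exact_mod_cast hm
    push_cast at this
    linarith
  have hcos : 2 / Real.pi ^ 2 * θ ^ 2 ≤ 1 - Real.cos θ := by
    linarith [Real.cos_le_one_sub_mul_cos_sq hθ]
  have hle : decayRate μ r a * n * θ ^ 2 ≤ v * (m + K) := by
    have e : decayRate μ r a * n * θ ^ 2
        = (w * (2 / Real.pi ^ 2 * θ ^ 2) * g) * (n / (r + 1)) := by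
      simp only [decayRate, hw, hg]; ring
    rw [e]
    refine mul_le_mul ?_ hmn (by positivity) hv0
    exact mul_le_mul_of_nonneg_right (mul_le_mul_of_nonneg_left hcos hw0) hg0
  calc (1 - v) ^ m ≤ Real.exp (-v) ^ m :=
        pow_le_pow_left₀ (by linarith) (Real.one_sub_le_exp_neg v) m
    _ = Real.exp (-(v * m)) := by rw [← Real.exp_nat_mul]; congr 1; ring
    _ ≤ Real.exp (2 * K) * Real.exp (-(decayRate μ r a * n * θ ^ 2)) := by
      rw [← Real.exp_add]
      refine Real.exp_le_exp.2 ?_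
      have hK : (0 : ℝ) ≤ K := Nat.cast_nonneg K
      nlinarith

/-- Gaussian decay of the characteristic function of the centered scan count. -/
theorem norm_integral_exp_scan_le {r : ℕ} (hr : 1 ≤ r) {a : ℝ} (ha : 0 < a) {θ : ℝ}
    (hθ : |θ| ≤ Real.pi) (p : ℝ) (n : ℕ) :
    ‖∫ x, Complex.exp ((θ * ∑ k ∈ Finset.Icc 1 n, (lowScan r a k x - p) : ℝ) * Complex.I)
        ∂(Measure.infinitePi fun _ : ℕ => μ)‖ ≤ Real.exp (-(decayRate μ r a * n * θ ^ 2)) := by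
  -- Exactly `⌈n/(r+1)⌉` blocks have their distinguished scan index in `[1, n]`, so no block is
  -- missing.
  have h := norm_integral_mul_exp_le_pow μ hr ha θ p (Finset.Icc 1 n) ∅
    (Finset.range ((n + r) / (r + 1))) ?_ (by simp) (ζ := fun _ => 1) measurable_const
    (by intro x y _; rfl) (M := 1) (by simp)
  · have h2 := pow_card_le_exp μ (r := r) ha hθ (n := n) (K := 0)
      (m := (Finset.range ((n + r) / (r + 1))).card) ?_
    · simpa using h.trans (by simpa using h2)
    · have := Nat.lt_div_mul_add (a := n + r) (Nat.succ_pos r)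
      rw [Finset.card_range]
      simp only [Nat.succ_eq_add_one] at this
      nlinarith
  · intro q hq
    rw [Finset.mem_range, Nat.lt_div_iff_mul_lt (Nat.succ_pos r)] at hq
    rw [Finset.mem_Icc, mul_comm]
    simp only [Nat.succ_eq_add_one] at hq
    omega

/-- Gaussian decay persists when the scans near `i` are removed and the exponential is weighted by
a function of the coordinates near `i`. -/
theorem norm_integral_mul_exp_scan_le {r : ℕ} (hr : 1 ≤ r) {a : ℝ} (ha : 0 < a) {θ : ℝ}
    (hθ : |θ| ≤ Real.pi) (p : ℝ) (n i : ℕ) (T : Finset ℕ)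
    (hT : ∀ k ∈ Finset.Icc 1 n, (k + 2 * r ≤ i ∨ i + 2 * r ≤ k) → k ∈ T)
    {ζ : (ℕ → ℝ) → ℂ} (hζ : Measurable ζ)
    (hζL : DependsOn ζ (Finset.Ico (i + 1 - 2 * r) (i + 3 * r))) {M : ℝ} (hM : ∀ x, ‖ζ x‖ ≤ M) :
    ‖∫ x, ζ x * Complex.exp ((θ * ∑ k ∈ T, (lowScan r a k x - p) : ℝ) * Complex.I)
        ∂(Measure.infinitePi fun _ : ℕ => μ)‖
      ≤ M * (Real.exp 14 * Real.exp (-(decayRate μ r a * n * θ ^ 2))) := by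
  -- The neighbourhood of `i` to be avoided reaches less than three block lengths either way, so it
  -- spoils at most seven blocks; `exp 14` is `exp (2K)` with `K = 7`.
  set bad := Finset.Icc (i / (r + 1) - 3) (i / (r + 1) + 3) with hbad
  have hgood : ∀ q ∉ bad, (r + 1) * q + 3 * r ≤ i ∨ i + 3 * r ≤ (r + 1) * q := by
    intro q hq
    by_contra hcon
    push Not at hcon
    refine hq (Finset.mem_Icc.2 ⟨?_, ?_⟩)
    · have : i / (r + 1) < q + 3 + 1 := by
        rw [Nat.div_lt_iff_lt_mul (Nat.succ_pos r)]
        simp only [Nat.succ_eq_add_one]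
        nlinarith
      omega
    · by_contra hlt
      push Not at hlt
      have h1 : (r + 1) * (i / (r + 1) + 4) ≤ (r + 1) * q := Nat.mul_le_mul_left _ hlt
      have h2 := Nat.lt_div_mul_add (a := i) (Nat.succ_pos r)
      simp only [Nat.succ_eq_add_one] at h2
      nlinarith
  have h := norm_integral_mul_exp_le_pow μ hr ha θ p T _
    (Finset.range ((n + r) / (r + 1)) \ bad) ?_ ?_ hζ hζL hM
  · have h2 := pow_card_le_exp μ (r := r) ha hθ (n := n) (K := 7)
      (m := (Finset.range ((n + r) / (r + 1)) \ bad).card) ?_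
    · refine h.trans (mul_le_mul_of_nonneg_left ?_ ((norm_nonneg _).trans (hM 0)))
      norm_num at h2 ⊢
      exact h2
    · have h1 := Nat.lt_div_mul_add (a := n + r) (Nat.succ_pos r)
      have h3 := Finset.le_card_sdiff bad (Finset.range ((n + r) / (r + 1)))
      have h4 : bad.card ≤ 7 := by rw [hbad, Nat.card_Icc]; omega
      rw [Finset.card_range] at h3
      have h5 : (n + r) / (r + 1) ≤ (Finset.range ((n + r) / (r + 1)) \ bad).card + 7 := by omega
      have h6 := Nat.mul_le_mul_left (r + 1) h5
      simp only [Nat.succ_eq_add_one] at h1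
      nlinarith
  · intro q hq
    rw [Finset.mem_sdiff, Finset.mem_range, Nat.lt_div_iff_mul_lt (Nat.succ_pos r)] at hq
    have := hgood q hq.2
    have h1 := hq.1
    simp only [Nat.succ_eq_add_one] at h1
    rw [mul_comm] at h1
    exact hT _ (Finset.mem_Icc.2 (by omega)) (by omega)
  · intro q hq
    rw [Finset.mem_sdiff] at hq
    have := hgood q hq.2
    rw [Finset.mem_Ico]
    omega

end Decay

/-! ### Local expansion of the derivative of the characteristic function. -/

section SteinIdentity

/-- The sum of the centered indicators of low scans with indices in `A`. -/
noncomputable def scanSum (r : ℕ) (a p : ℝ) (A : Finset ℕ) (x : ℕ → ℝ) : ℝ :=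
  ∑ k ∈ A, (lowScan r a k x - p)

theorem measurable_scanSum (r : ℕ) (a p : ℝ) (A : Finset ℕ) : Measurable (scanSum r a p A) :=
  Finset.measurable_sum _ fun k _ => (measurable_lowScan r a k).sub_const p

theorem dependsOn_scanSum (r : ℕ) (a p : ℝ) (A : Finset ℕ) :
    DependsOn (scanSum r a p A) (A.biUnion fun k => Finset.Ico k (k + r)) := by
  intro x y h
  refine Finset.sum_congr rfl fun k hk => ?_
  rw [dependsOn_lowScan r a k fun j hj => h j ?_]
  simp only [Finset.coe_biUnion, Set.mem_iUnion]
  exact ⟨k, hk, hj⟩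

theorem abs_lowScan_sub_le {p : ℝ} (hp0 : 0 ≤ p) (hp1 : p ≤ 1) (r : ℕ) (a : ℝ) (k : ℕ)
    (x : ℕ → ℝ) : |lowScan r a k x - p| ≤ 1 := by
  have h0 := lowScan_nonneg r a k x
  have h1 := lowScan_le_one r a k x
  rw [abs_le]
  constructor <;> linarith

theorem abs_scanSum_le {p : ℝ} (hp0 : 0 ≤ p) (hp1 : p ≤ 1) (r : ℕ) (a : ℝ) (A : Finset ℕ)
    (x : ℕ → ℝ) : |scanSum r a p A x| ≤ A.card := by
  refine (Finset.abs_sum_le_sum_abs _ _).trans ?_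
  refine (Finset.sum_le_sum fun k _ => abs_lowScan_sub_le hp0 hp1 r a k x).trans ?_
  simp

theorem norm_exp_mul_I_sub_one_le (y : ℝ) : ‖Complex.exp (y * Complex.I) - 1‖ ≤ |y| := by
  have := Real.norm_exp_I_mul_ofReal_sub_one_le (x := y)
  rwa [mul_comm, Real.norm_eq_abs] at this

/-- Mean value inequality on `[-|y|, |y|]`, where the derivative `i(exp(it) - 1)` has norm at most
`|y|`; the sharp factor `1/2` is not needed. -/
theorem norm_exp_mul_I_sub_one_sub_le (y : ℝ) :
    ‖Complex.exp (y * Complex.I) - 1 - y * Complex.I‖ ≤ y ^ 2 := by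
  have hd : ∀ t : ℝ, HasDerivAt (fun t : ℝ => Complex.exp (t * Complex.I) - 1 - t * Complex.I)
      (Complex.exp (t * Complex.I) * Complex.I - Complex.I) t := by
    intro t
    have h1 : HasDerivAt (fun t : ℝ => (t : ℂ) * Complex.I) Complex.I t := by
      simpa using (Complex.ofRealCLM.hasDerivAt (x := t)).mul_const Complex.I
    exact (h1.cexp.sub_const 1).sub h1
  have := (convex_Icc (-|y|) |y|).norm_image_sub_le_of_norm_hasDerivWithin_le (C := |y|)
    (f := fun t : ℝ => Complex.exp (t * Complex.I) - 1 - t * Complex.I)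
    (fun t _ => (hd t).hasDerivWithinAt) ?_ (x := 0) (y := y) (by simp)
    (Set.mem_Icc.2 ⟨neg_abs_le y, le_abs_self y⟩)
  · simpa [← sq, sq_abs] using this
  · intro t ht
    rw [← sub_one_mul, norm_mul, Complex.norm_I, mul_one]
    exact (norm_exp_mul_I_sub_one_le t).trans (abs_le.2 ht)

variable (μ : Measure ℝ) [IsProbabilityMeasure μ]

theorem integrable_infinitePi_of_bound {E : Type*} [NormedAddCommGroup E] {f : (ℕ → ℝ) → E}
    (hf : AEStronglyMeasurable f (Measure.infinitePi fun _ : ℕ => μ)) {M : ℝ}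
    (hM : ∀ x, ‖f x‖ ≤ M) : Integrable f (Measure.infinitePi fun _ : ℕ => μ) :=
  Integrable.of_bound hf M (Filter.Eventually.of_forall hM)

/-- Stationarity: the product measure is invariant under shifting the coordinates. -/
theorem integral_lowScan_eq (r : ℕ) (a : ℝ) (k : ℕ) :
    ∫ x, lowScan r a k x ∂(Measure.infinitePi fun _ : ℕ => μ)
      = ∫ x, lowScan r a 1 x ∂(Measure.infinitePi fun _ : ℕ => μ) := by
  have key : ∀ k, ∫ x, lowScan r a k x ∂(Measure.infinitePi fun _ : ℕ => μ)
      = ∫ x, lowScan r a 0 x ∂(Measure.infinitePi fun _ : ℕ => μ) := by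
    intro k
    have hinj : Function.Injective fun j : ℕ => k + j := add_right_injective k
    have h : (Measure.infinitePi fun _ : ℕ => μ).map (fun (x : ℕ → ℝ) (j : ℕ) => x (k + j))
        = Measure.infinitePi fun _ : ℕ => μ :=
      Measure.map_infinitePi_infinitePi_of_inj (P := fun _ : ℕ => μ) hinj
    have hm : Measurable fun (x : ℕ → ℝ) (j : ℕ) => x (k + j) :=
      measurable_pi_lambda _ fun j => measurable_pi_apply _
    have h2 := integral_map hm.aemeasurable (μ := Measure.infinitePi fun _ : ℕ => μ)
      (measurable_lowScan r a 0).aestronglyMeasurable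
    rw [h] at h2
    rw [h2]
    refine integral_congr_ae (Filter.Eventually.of_forall fun x => ?_)
    simp [lowScan, rScan, Set.indicator_apply]
  rw [key k, key 1]

/-- Two scan sums over index sets at distance at least `r` are uncorrelated, together with any
functions of them. -/
theorem integral_mul_comp_scanSum {r : ℕ} {a p : ℝ} {i : ℕ} {A : Finset ℕ}
    (hA : ∀ k ∈ A, k + r ≤ i ∨ i + r ≤ k) (hp : ∫ x, lowScan r a i x
      ∂(Measure.infinitePi fun _ : ℕ => μ) = p) {F : ℝ → ℂ} (hF : Measurable F) :
    ∫ x, ((lowScan r a i x - p : ℝ) : ℂ) * F (scanSum r a p A x)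
      ∂(Measure.infinitePi fun _ : ℕ => μ) = 0 := by
  rw [integral_mul_of_dependsOn μ (S := Finset.Ico i (i + r))
    (T := A.biUnion fun k => Finset.Ico k (k + r))
    (f := fun x => ((lowScan r a i x - p : ℝ) : ℂ)) (g := fun x => F (scanSum r a p A x))
    (Complex.measurable_ofReal.comp ((measurable_lowScan r a i).sub_const p))
    (hF.comp (measurable_scanSum r a p A))]
  · rw [integral_complex_ofReal, integral_sub, hp]
    · simp
    · exact integrable_infinitePi_of_bound μ (measurable_lowScan r a i).aestronglyMeasurable
        (M := 1) fun x => by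
          rw [Real.norm_of_nonneg (lowScan_nonneg _ _ _ _)]; exact lowScan_le_one _ _ _ _
    · exact integrable_const _
  · rw [Finset.disjoint_left]
    intro j hj hj'
    simp only [Finset.mem_biUnion, Finset.mem_Ico] at hj hj'
    obtain ⟨k, hk, hk1, hk2⟩ := hj'
    have := hA k hk
    omega
  · intro x y h
    simp only [dependsOn_lowScan r a i h]
  · intro x y h
    simp only [dependsOn_scanSum r a p A h]

/-- The indices in `{1, …, n}` at distance less than `d` from `i`. -/
def nearIndices (n d i : ℕ) : Finset ℕ :=
  (Finset.Icc 1 n).filter fun k => k < i + d ∧ i < k + d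

/-- The indices in `{1, …, n}` at distance at least `d` from `i`. -/
def farIndices (n d i : ℕ) : Finset ℕ :=
  (Finset.Icc 1 n).filter fun k => ¬ (k < i + d ∧ i < k + d)

theorem card_nearIndices_le (n d i : ℕ) : (nearIndices n d i).card ≤ 2 * d := by
  have : nearIndices n d i ⊆ Finset.Ico (i + 1 - d) (i + d) := by
    intro k hk
    simp only [nearIndices, Finset.mem_filter, Finset.mem_Ico] at hk ⊢
    omega
  refine (Finset.card_le_card this).trans ?_
  rw [Nat.card_Ico]
  omega

theorem scanSum_near_add_far (r : ℕ) (a p : ℝ) (n d i : ℕ) (x : ℕ → ℝ) :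
    scanSum r a p (nearIndices n d i) x + scanSum r a p (farIndices n d i) x
      = scanSum r a p (Finset.Icc 1 n) x :=
  Finset.sum_filter_add_sum_filter_not _ _ _

theorem abs_scanSum_near_le {p : ℝ} (hp0 : 0 ≤ p) (hp1 : p ≤ 1) (r : ℕ) (a : ℝ) (n d i : ℕ)
    (x : ℕ → ℝ) : |scanSum r a p (nearIndices n d i) x| ≤ 2 * d := by
  refine (abs_scanSum_le hp0 hp1 r a _ x).trans ?_
  exact_mod_cast card_nearIndices_le n d i

theorem dependsOn_scanSum_near {r d i : ℕ} (a p : ℝ) (n : ℕ) {S : Set ℕ}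
    (hS : ∀ j, j + 1 < i + d + r → i < j + d → j ∈ S) :
    DependsOn (scanSum r a p (nearIndices n d i)) S := by
  intro x y h
  refine dependsOn_scanSum r a p _ fun j hj => h j (hS j ?_ ?_) <;>
  · simp only [Finset.coe_biUnion, Set.mem_iUnion, nearIndices, Finset.mem_coe, Finset.mem_filter,
      Finset.coe_Ico, Set.mem_Ico] at hj
    obtain ⟨k, hk, hj⟩ := hj
    omega

/-- The local expansion of one summand in the derivative of the characteristic function. -/
theorem norm_integral_scan_mul_exp_sub_le {r : ℕ} (hr : 1 ≤ r) {a : ℝ} (ha : 0 < a) {θ : ℝ}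
    (hθ : |θ| ≤ Real.pi) {p : ℝ} (hp0 : 0 ≤ p) (hp1 : p ≤ 1) (n i : ℕ)
    (hp : ∫ x, lowScan r a i x ∂(Measure.infinitePi fun _ : ℕ => μ) = p) :
    ‖(∫ x, ((lowScan r a i x - p : ℝ) : ℂ)
          * Complex.exp ((θ * scanSum r a p (Finset.Icc 1 n) x : ℝ) * Complex.I)
          ∂(Measure.infinitePi fun _ : ℕ => μ))
        - θ * Complex.I * ((∫ x, (lowScan r a i x - p) * scanSum r a p (nearIndices n r i) x
          ∂(Measure.infinitePi fun _ : ℕ => μ) : ℝ) : ℂ)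
        * ∫ x, Complex.exp ((θ * scanSum r a p (Finset.Icc 1 n) x : ℝ) * Complex.I)
          ∂(Measure.infinitePi fun _ : ℕ => μ)‖
      ≤ 24 * r ^ 2 * θ ^ 2 * (Real.exp 14 * Real.exp (-(decayRate μ r a * n * θ ^ 2))) := by
  set ν := Measure.infinitePi fun _ : ℕ => μ with hν
  set ξ : (ℕ → ℝ) → ℝ := fun x => lowScan r a i x - p with hξ
  set W := scanSum r a p (Finset.Icc 1 n) with hW
  set V₁ := scanSum r a p (nearIndices n r i) with hV₁
  set V₂ := scanSum r a p (nearIndices n (2 * r) i) with hV₂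
  set U := scanSum r a p (farIndices n (2 * r) i) with hU
  set Z := scanSum r a p (farIndices n r i) with hZ
  set E : ℝ → ℂ := fun y => Complex.exp ((θ * y : ℝ) * Complex.I) with hE
  have hEadd : ∀ y z, E (y + z) = E y * E z := by
    intro y z
    simp only [hE]
    rw [← Complex.exp_add]
    congr 1
    push_cast
    ring
  have hE1 : ∀ y, ‖E y‖ = 1 := fun y => Complex.norm_exp_ofReal_mul_I _
  have hEm : Measurable E := by simp only [hE]; fun_prop
  have hWZ : ∀ x, W x = V₁ x + Z x := fun x => (scanSum_near_add_far r a p n r i x).symm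
  have hWU : ∀ x, W x = V₂ x + U x := fun x => (scanSum_near_add_far r a p n (2 * r) i x).symm
  have hξm : Measurable ξ := (measurable_lowScan r a i).sub_const p
  have hV₁m : Measurable V₁ := measurable_scanSum _ _ _ _
  have hV₂m : Measurable V₂ := measurable_scanSum _ _ _ _
  have hUm : Measurable U := measurable_scanSum _ _ _ _
  have hZm : Measurable Z := measurable_scanSum _ _ _ _
  have hWm : Measurable W := measurable_scanSum _ _ _ _
  have hξ1 : ∀ x, |ξ x| ≤ 1 := abs_lowScan_sub_le hp0 hp1 r a i
  have hV₁b : ∀ x, |V₁ x| ≤ 2 * r := abs_scanSum_near_le hp0 hp1 r a n r i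
  have hV₂b : ∀ x, |V₂ x| ≤ 4 * r := by
    intro x
    have := abs_scanSum_near_le hp0 hp1 r a n (2 * r) i x
    push_cast at this
    linarith
  have hξC : Measurable fun x => (ξ x : ℂ) := Complex.measurable_ofReal.comp hξm
  have hV₁C : Measurable fun x => (V₁ x : ℂ) := Complex.measurable_ofReal.comp hV₁m
  -- With `W = V₁ + Z = V₂ + U`, the mean of `ξ E(Z)` vanishes, so `ξ E(W)` has the same mean as `ξ
  -- (E(V₂) - E(V₂ - V₁)) E(U)`. The linear part of the bracket is `iθV₁`, and `ξV₁` is independent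
  -- of `U`. The remainder is `ζ₁`, while `ζ₂` pays for replacing `E(U)` by `E(W)`. Both depend only
  -- on coordinates near `i`, so the weighted decay estimate applies to them.
  set ζ₁ : (ℕ → ℝ) → ℂ := fun x =>
    (ξ x : ℂ) * (E (V₂ x) - E (V₂ x - V₁ x) - θ * Complex.I * V₁ x) with hζ₁
  set ζ₂ : (ℕ → ℝ) → ℂ := fun x => E (V₂ x) - 1 with hζ₂
  have hζ₁m : Measurable ζ₁ :=
    hξC.mul (((hEm.comp hV₂m).sub (hEm.comp (hV₂m.sub hV₁m))).sub (hV₁C.const_mul _))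
  have hζ₂m : Measurable ζ₂ := (hEm.comp hV₂m).sub_const 1
  have hEbound : ∀ y, ‖E y - 1‖ ≤ |θ| * |y| := by
    intro y
    have := norm_exp_mul_I_sub_one_le (θ * y)
    rwa [abs_mul] at this
  -- The second-order Taylor error gives `(2r)²θ²`, and removing the phase `E(V₂ - V₁)` from the
  -- linear term gives `(2r)(6r)θ²`. Adding `(2r)(4r)θ²` from `ζ₂` at the end makes `24r²θ²`.
  have hζ₁b : ∀ x, ‖ζ₁ x‖ ≤ 16 * r ^ 2 * θ ^ 2 := by
    intro x
    have e : E (V₂ x) - E (V₂ x - V₁ x) - θ * Complex.I * V₁ x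
        = E (V₂ x - V₁ x) * (E (V₁ x) - 1 - (θ * V₁ x : ℝ) * Complex.I)
          + (θ * V₁ x : ℝ) * Complex.I * (E (V₂ x - V₁ x) - 1) := by
      have : E (V₂ x) = E (V₂ x - V₁ x) * E (V₁ x) := by rw [← hEadd]; congr 1; ring
      rw [this]
      push_cast
      ring
    have h1 := norm_exp_mul_I_sub_one_sub_le (θ * V₁ x)
    have h2 := hEbound (V₂ x - V₁ x)
    have h3 : |V₂ x - V₁ x| ≤ 6 * r := by
      refine (abs_sub _ _).trans ?_
      linarith [hV₁b x, hV₂b x]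
    have hr0 : (0 : ℝ) ≤ r := Nat.cast_nonneg r
    have h4 : V₁ x ^ 2 ≤ (2 * r) ^ 2 := sq_le_sq' (by linarith [abs_le.1 (hV₁b x)])
      (abs_le.1 (hV₁b x)).2
    simp only [hζ₁]
    rw [norm_mul, e, Complex.norm_real, Real.norm_eq_abs]
    have h5 : ‖E (V₂ x - V₁ x) * (E (V₁ x) - 1 - (θ * V₁ x : ℝ) * Complex.I)
          + (θ * V₁ x : ℝ) * Complex.I * (E (V₂ x - V₁ x) - 1)‖
        ≤ (θ * V₁ x) ^ 2 + |θ| * |V₁ x| * (|θ| * |V₂ x - V₁ x|) := by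
      refine (norm_add_le _ _).trans (add_le_add ?_ ?_)
      · rw [norm_mul, hE1, one_mul]; exact h1
      · rw [norm_mul, norm_mul, Complex.norm_I, mul_one, Complex.norm_real, Real.norm_eq_abs,
          abs_mul]
        exact mul_le_mul_of_nonneg_left h2 (by positivity)
    have h6 : |V₁ x| * |V₂ x - V₁ x| ≤ (2 * r) * (6 * r) :=
      mul_le_mul (hV₁b x) h3 (abs_nonneg _) (by positivity)
    have h7 : (θ * V₁ x) ^ 2 + |θ| * |V₁ x| * (|θ| * |V₂ x - V₁ x|) ≤ 16 * r ^ 2 * θ ^ 2 := by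
      have : |θ| * |V₁ x| * (|θ| * |V₂ x - V₁ x|) = θ ^ 2 * (|V₁ x| * |V₂ x - V₁ x|) := by
        rw [← sq_abs θ]; ring
      rw [this]
      nlinarith [sq_nonneg θ]
    calc |ξ x| * _ ≤ 1 * (16 * r ^ 2 * θ ^ 2) :=
          mul_le_mul (hξ1 x) (h5.trans h7) (norm_nonneg _) zero_le_one
      _ = _ := one_mul _
  have hζ₂b : ∀ x, ‖ζ₂ x‖ ≤ |θ| * (4 * r) := fun x =>
    (hEbound _).trans (mul_le_mul_of_nonneg_left (hV₂b x) (abs_nonneg θ))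
  have hV₁d : DependsOn V₁ (Finset.Ico (i + 1 - 2 * r) (i + 3 * r)) :=
    dependsOn_scanSum_near a p n fun j h1 h2 => by
      simp only [Finset.coe_Ico, Set.mem_Ico]; omega
  have hV₂d : DependsOn V₂ (Finset.Ico (i + 1 - 2 * r) (i + 3 * r)) :=
    dependsOn_scanSum_near a p n fun j h1 h2 => by
      simp only [Finset.coe_Ico, Set.mem_Ico]; omega
  have hξd : DependsOn ξ (Finset.Ico i (i + r)) := fun x y h => by
    simp only [hξ, dependsOn_lowScan r a i h]
  have hsub : (Finset.Ico i (i + r) : Set ℕ) ⊆ Finset.Ico (i + 1 - 2 * r) (i + 3 * r) := by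
    intro j hj
    simp only [Finset.coe_Ico, Set.mem_Ico] at hj ⊢
    omega
  have hfar : ∀ k ∈ Finset.Icc 1 n, (k + 2 * r ≤ i ∨ i + 2 * r ≤ k) → k ∈ farIndices n (2 * r) i :=
    fun k hk h => Finset.mem_filter.2 ⟨hk, by omega⟩
  have hI₁ := norm_integral_mul_exp_scan_le μ hr ha hθ p n i (farIndices n (2 * r) i) hfar hζ₁m
    (fun x y h => by
      simp only [hζ₁]
      rw [hV₁d h, hV₂d h, hξd fun j hj => h j (hsub hj)]) hζ₁b
  have hI₂ := norm_integral_mul_exp_scan_le μ hr ha hθ p n i (farIndices n (2 * r) i) hfar hζ₂m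
    (fun x y h => by
      simp only [hζ₂]
      rw [hV₂d h]) hζ₂b
  change ‖∫ x, ζ₁ x * E (U x) ∂ν‖ ≤ _ at hI₁
  change ‖∫ x, ζ₂ x * E (U x) ∂ν‖ ≤ _ at hI₂
  change ‖(∫ x, (ξ x : ℂ) * E (W x) ∂ν) - θ * Complex.I * ((∫ x, ξ x * V₁ x ∂ν : ℝ) : ℂ)
    * ∫ x, E (W x) ∂ν‖ ≤ _
  set m := ∫ x, ξ x * V₁ x ∂ν with hm
  have hmb : |m| ≤ 2 * r := by
    have := norm_integral_le_of_norm_le_const (μ := ν) (f := fun x => ξ x * V₁ x) (C := 2 * r)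
      (Filter.Eventually.of_forall fun x => by
        rw [norm_mul, Real.norm_eq_abs, Real.norm_eq_abs]
        calc |ξ x| * |V₁ x| ≤ 1 * (2 * r) :=
              mul_le_mul (hξ1 x) (hV₁b x) (abs_nonneg _) zero_le_one
          _ = _ := one_mul _)
    simpa using this
  have hEU : Measurable fun x => E (U x) := hEm.comp hUm
  have i1 : Integrable (fun x => ζ₁ x * E (U x)) ν :=
    integrable_infinitePi_of_bound μ (hζ₁m.mul hEU).aestronglyMeasurable fun x => by
      rw [norm_mul, hE1, mul_one]; exact hζ₁b x
  have i2 : Integrable (fun x => ζ₂ x * E (U x)) ν :=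
    integrable_infinitePi_of_bound μ (hζ₂m.mul hEU).aestronglyMeasurable fun x => by
      rw [norm_mul, hE1, mul_one]; exact hζ₂b x
  have i3 : Integrable (fun x => (ξ x : ℂ) * E (Z x)) ν :=
    integrable_infinitePi_of_bound μ (hξC.mul (hEm.comp hZm)).aestronglyMeasurable (M := 1)
      fun x => by
        rw [norm_mul, hE1, mul_one, Complex.norm_real]; exact hξ1 x
  have i4 : Integrable (fun x => ((ξ x * V₁ x : ℝ) : ℂ) * E (U x)) ν :=
    integrable_infinitePi_of_bound μ
      ((Complex.measurable_ofReal.comp (hξm.mul hV₁m)).mul hEU).aestronglyMeasurable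
      (M := 1 * (2 * r)) fun x => by
        rw [norm_mul, hE1, mul_one, Complex.norm_real, norm_mul]
        exact mul_le_mul (hξ1 x) (hV₁b x) (abs_nonneg _) zero_le_one
  have i5 : Integrable (fun x => E (W x)) ν :=
    integrable_infinitePi_of_bound μ (hEm.comp hWm).aestronglyMeasurable fun x => (hE1 _).le
  have hzero : ∫ x, (ξ x : ℂ) * E (Z x) ∂ν = 0 :=
    integral_mul_comp_scanSum μ (fun k hk => by
      have := (Finset.mem_filter.1 hk).2
      omega) hp hEm
  have hprod : ∫ x, ((ξ x * V₁ x : ℝ) : ℂ) * E (U x) ∂ν = m * ∫ x, E (U x) ∂ν := by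
    rw [integral_mul_of_dependsOn μ (S := Finset.Ico (i + 1 - r) (i + 2 * r))
      (T := (farIndices n (2 * r) i).biUnion fun k => Finset.Ico k (k + r))
      (f := fun x => ((ξ x * V₁ x : ℝ) : ℂ)) (g := fun x => E (U x))
      (Complex.measurable_ofReal.comp (hξm.mul hV₁m)) hEU, integral_complex_ofReal]
    · rw [Finset.disjoint_left]
      intro j hj hj'
      simp only [Finset.mem_biUnion, Finset.mem_Ico, farIndices, Finset.mem_filter] at hj hj'
      obtain ⟨k, hk, hk1, hk2⟩ := hj'
      omega
    · intro x y h
      have h1 : V₁ x = V₁ y := dependsOn_scanSum_near a p n (S := Finset.Ico (i + 1 - r) (i + 2 * r))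
        (fun j h1 h2 => by simp only [Finset.coe_Ico, Set.mem_Ico]; omega) h
      have h2 : ξ x = ξ y := hξd fun j hj => h j (by
        simp only [Finset.coe_Ico, Set.mem_Ico] at hj ⊢
        omega)
      simp only [h1, h2]
    · intro x y h
      simp only [hU, dependsOn_scanSum r a p _ h]
  have hA : ∫ x, (ξ x : ℂ) * E (W x) ∂ν
      = θ * Complex.I * (m * ∫ x, E (U x) ∂ν) + ∫ x, ζ₁ x * E (U x) ∂ν := by
    have : ∀ x, (ξ x : ℂ) * E (W x) = (ξ x : ℂ) * E (Z x)
        + (θ * Complex.I * (((ξ x * V₁ x : ℝ) : ℂ) * E (U x)) + ζ₁ x * E (U x)) := by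
      intro x
      have e1 : E (W x) = E (V₂ x) * E (U x) := by rw [hWU, hEadd]
      have e2 : E (Z x) = E (V₂ x - V₁ x) * E (U x) := by
        rw [← hEadd]; congr 1; linarith [hWU x, hWZ x]
      simp only [hζ₁]
      rw [e1, e2]
      push_cast
      ring
    have i6 : Integrable (fun x => θ * Complex.I * (((ξ x * V₁ x : ℝ) : ℂ) * E (U x))) ν :=
      i4.const_mul _
    have i7 : Integrable (fun x => θ * Complex.I * (((ξ x * V₁ x : ℝ) : ℂ) * E (U x))
        + ζ₁ x * E (U x)) ν := i6.add i1
    simp_rw [this]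
    rw [integral_add i3 i7, integral_add i6 i1,
      integral_const_mul, hzero, hprod, zero_add]
  have hB : ∫ x, E (U x) ∂ν = (∫ x, E (W x) ∂ν) - ∫ x, ζ₂ x * E (U x) ∂ν := by
    rw [← integral_sub i5 i2]
    refine integral_congr_ae (Filter.Eventually.of_forall fun x => ?_)
    simp only [hζ₂]
    rw [hWU, hEadd]
    ring
  rw [hA, hB]
  have e : ∀ P Q R : ℂ, (θ : ℂ) * Complex.I * (m * (P - Q)) + R - θ * Complex.I * m * P
      = R - θ * Complex.I * m * Q := by intros; ring
  rw [e]
  refine (norm_sub_le _ _).trans ?_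
  rw [norm_mul, norm_mul, norm_mul, Complex.norm_I, mul_one, Complex.norm_real, Complex.norm_real,
    Real.norm_eq_abs, Real.norm_eq_abs]
  set D := Real.exp 14 * Real.exp (-(decayRate μ r a * n * θ ^ 2)) with hD
  have hD0 : 0 ≤ D := by positivity
  have h8 : |θ| * |m| * ‖∫ x, ζ₂ x * E (U x) ∂ν‖ ≤ |θ| * (2 * r) * (|θ| * (4 * r) * D) :=
    mul_le_mul (mul_le_mul_of_nonneg_left hmb (abs_nonneg θ)) hI₂ (norm_nonneg _) (by positivity)
  have h9 : |θ| * (2 * r) * (|θ| * (4 * r) * D) = 8 * r ^ 2 * θ ^ 2 * D := by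
    rw [← sq_abs θ]; ring
  linarith

end SteinIdentity

/-! ### Variance of the scan count and the approximate differential equation. -/

section ScanMoments

variable (μ : Measure ℝ) [IsProbabilityMeasure μ]

theorem integral_lowScan_mem (r : ℕ) (a : ℝ) (k : ℕ) :
    0 ≤ ∫ x, lowScan r a k x ∂(Measure.infinitePi fun _ : ℕ => μ) ∧
      ∫ x, lowScan r a k x ∂(Measure.infinitePi fun _ : ℕ => μ) ≤ 1 := by
  refine ⟨integral_nonneg fun x => lowScan_nonneg r a k x, ?_⟩
  have := norm_integral_le_of_norm_le_const (μ := Measure.infinitePi fun _ : ℕ => μ)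
    (f := lowScan r a k) (C := 1) (Filter.Eventually.of_forall fun x => by
      rw [Real.norm_of_nonneg (lowScan_nonneg _ _ _ _)]; exact lowScan_le_one _ _ _ _)
  exact (le_abs_self _).trans (by simpa using this)

/-- The second moment of the centered scan count, written as a sum over pairs of nearby scans. -/
theorem integral_scanSum_sq {r : ℕ} {a p : ℝ} (hp0 : 0 ≤ p) (hp1 : p ≤ 1)
    (hp : ∀ i, ∫ x, lowScan r a i x ∂(Measure.infinitePi fun _ : ℕ => μ) = p) (n : ℕ) :
    ∫ x, scanSum r a p (Finset.Icc 1 n) x ^ 2 ∂(Measure.infinitePi fun _ : ℕ => μ)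
      = ∑ i ∈ Finset.Icc 1 n, ∫ x, (lowScan r a i x - p) * scanSum r a p (nearIndices n r i) x
          ∂(Measure.infinitePi fun _ : ℕ => μ) := by
  have hint : ∀ i A, Integrable (fun x => (lowScan r a i x - p) * scanSum r a p A x)
      (Measure.infinitePi fun _ : ℕ => μ) := fun i A =>
    integrable_infinitePi_of_bound μ (((measurable_lowScan r a i).sub_const p).mul
      (measurable_scanSum r a p A)).aestronglyMeasurable (M := 1 * A.card) fun x => by
        rw [norm_mul]
        exact mul_le_mul (abs_lowScan_sub_le hp0 hp1 r a i x) (abs_scanSum_le hp0 hp1 r a A x)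
          (abs_nonneg _) zero_le_one
  have h1 : ∀ x, scanSum r a p (Finset.Icc 1 n) x ^ 2 = ∑ i ∈ Finset.Icc 1 n,
      (lowScan r a i x - p) * scanSum r a p (Finset.Icc 1 n) x := by
    intro x
    rw [← Finset.sum_mul, sq]
    rfl
  simp_rw [h1]
  rw [integral_finsetSum _ fun i _ => hint i _]
  refine Finset.sum_congr rfl fun i _ => ?_
  have h2 : ∀ x, (lowScan r a i x - p) * scanSum r a p (Finset.Icc 1 n) x
      = (lowScan r a i x - p) * scanSum r a p (nearIndices n r i) x
        + (lowScan r a i x - p) * scanSum r a p (farIndices n r i) x := by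
    intro x
    rw [← mul_add, scanSum_near_add_far]
  simp_rw [h2]
  rw [integral_add (hint _ _) (hint _ _)]
  have h3 := integral_mul_comp_scanSum μ (A := farIndices n r i) (r := r) (i := i) (a := a)
    (fun k hk => by
      have := (Finset.mem_filter.1 hk).2
      omega) (hp i) Complex.measurable_ofReal
  have h4 : ∫ x, (lowScan r a i x - p) * scanSum r a p (farIndices n r i) x
      ∂(Measure.infinitePi fun _ : ℕ => μ) = 0 := by
    have : ∀ x, ((lowScan r a i x - p : ℝ) : ℂ) * ((scanSum r a p (farIndices n r i) x : ℝ) : ℂ)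
        = (((lowScan r a i x - p) * scanSum r a p (farIndices n r i) x : ℝ) : ℂ) := by
      intro x; push_cast; ring
    simp_rw [this] at h3
    rw [integral_complex_ofReal] at h3
    exact_mod_cast h3
  rw [h4, add_zero]

/-- Each centered indicator is correlated only with those at distance less than `r`, fewer than `2r`
of them, each covariance being at most `1`. -/
theorem integral_scanSum_sq_le {r : ℕ} {a p : ℝ} (hp0 : 0 ≤ p) (hp1 : p ≤ 1)
    (hp : ∀ i, ∫ x, lowScan r a i x ∂(Measure.infinitePi fun _ : ℕ => μ) = p) (n : ℕ) :
    ∫ x, scanSum r a p (Finset.Icc 1 n) x ^ 2 ∂(Measure.infinitePi fun _ : ℕ => μ)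
      ≤ 2 * r * n := by
  rw [integral_scanSum_sq μ hp0 hp1 hp]
  have : ∀ i ∈ Finset.Icc 1 n, ∫ x, (lowScan r a i x - p) * scanSum r a p (nearIndices n r i) x
          ∂(Measure.infinitePi fun _ : ℕ => μ) ≤ 2 * r := by
    intro i _
    have := norm_integral_le_of_norm_le_const (μ := Measure.infinitePi fun _ : ℕ => μ)
      (f := fun x => (lowScan r a i x - p) * scanSum r a p (nearIndices n r i) x) (C := 2 * r)
      (Filter.Eventually.of_forall fun x => by
        rw [norm_mul]
        calc _ ≤ 1 * (2 * (r : ℝ)) :=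
              mul_le_mul (abs_lowScan_sub_le hp0 hp1 r a i x)
                (abs_scanSum_near_le hp0 hp1 r a n r i x) (abs_nonneg _) zero_le_one
          _ = _ := one_mul _)
    exact (le_abs_self _).trans (by simpa using this)
  refine (Finset.sum_le_sum this).trans (le_of_eq ?_)
  simp [mul_comm]

/-- The characteristic function of the centered scan count nearly satisfies the differential
equation of a Gaussian characteristic function. -/
theorem norm_integral_scanSum_mul_exp_sub_le {r : ℕ} (hr : 1 ≤ r) {a : ℝ} (ha : 0 < a) {θ : ℝ}
    (hθ : |θ| ≤ Real.pi) {p : ℝ} (hp0 : 0 ≤ p) (hp1 : p ≤ 1)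
    (hp : ∀ i, ∫ x, lowScan r a i x ∂(Measure.infinitePi fun _ : ℕ => μ) = p) (n : ℕ) :
    ‖(∫ x, (scanSum r a p (Finset.Icc 1 n) x : ℂ)
          * Complex.exp ((θ * scanSum r a p (Finset.Icc 1 n) x : ℝ) * Complex.I)
          ∂(Measure.infinitePi fun _ : ℕ => μ))
        - θ * Complex.I * ((∫ x, scanSum r a p (Finset.Icc 1 n) x ^ 2
          ∂(Measure.infinitePi fun _ : ℕ => μ) : ℝ) : ℂ)
        * ∫ x, Complex.exp ((θ * scanSum r a p (Finset.Icc 1 n) x : ℝ) * Complex.I)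
          ∂(Measure.infinitePi fun _ : ℕ => μ)‖
      ≤ 24 * r ^ 2 * Real.exp 14 * n * θ ^ 2 * Real.exp (-(decayRate μ r a * n * θ ^ 2)) := by
  rw [integral_scanSum_sq μ hp0 hp1 hp]
  set e : (ℕ → ℝ) → ℂ := fun x =>
    Complex.exp ((θ * scanSum r a p (Finset.Icc 1 n) x : ℝ) * Complex.I) with he
  have hem : Measurable e := by
    have := measurable_scanSum r a p (Finset.Icc 1 n)
    simp only [he]
    fun_prop
  have h1 : ∫ x, (scanSum r a p (Finset.Icc 1 n) x : ℂ) * e x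
        ∂(Measure.infinitePi fun _ : ℕ => μ)
      = ∑ i ∈ Finset.Icc 1 n, ∫ x, ((lowScan r a i x - p : ℝ) : ℂ) * e x
        ∂(Measure.infinitePi fun _ : ℕ => μ) := by
    rw [← integral_finsetSum]
    · refine integral_congr_ae (Filter.Eventually.of_forall fun x => ?_)
      simp only [scanSum]
      rw [← Finset.sum_mul]
      push_cast
      rfl
    · intro i _
      refine integrable_infinitePi_of_bound μ ((Complex.measurable_ofReal.comp
        ((measurable_lowScan r a i).sub_const p)).mul hem).aestronglyMeasurable (M := 1)
        fun x => ?_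
      rw [norm_mul, Complex.norm_exp_ofReal_mul_I, mul_one, Complex.norm_real]
      exact abs_lowScan_sub_le hp0 hp1 r a i x
  rw [h1, Complex.ofReal_sum, Finset.mul_sum, Finset.sum_mul, ← Finset.sum_sub_distrib]
  refine (norm_sum_le_of_le _ fun i _ =>
    norm_integral_scan_mul_exp_sub_le μ hr ha hθ hp0 hp1 n i (hp i)).trans (le_of_eq ?_)
  rw [Finset.sum_const, Nat.card_Icc, nsmul_eq_mul]
  push_cast
  ring

/-- The variance of the scan count grows linearly. -/
theorem two_mul_decayRate_le {r : ℕ} (hr : 1 ≤ r) {a : ℝ} (ha : 0 < a) {p : ℝ} (hp0 : 0 ≤ p)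
    (hp1 : p ≤ 1) (hc : 0 < decayRate μ r a) (n : ℕ) :
    2 * (decayRate μ r a * n) ≤
      ∫ x, scanSum r a p (Finset.Icc 1 n) x ^ 2 ∂(Measure.infinitePi fun _ : ℕ => μ) := by
  set W := scanSum r a p (Finset.Icc 1 n) with hW
  set s := ∫ x, W x ^ 2 ∂(Measure.infinitePi fun _ : ℕ => μ) with hs
  have hs0 : 0 ≤ s := integral_nonneg fun x => sq_nonneg _
  set y := decayRate μ r a * n with hy
  have hy0 : 0 ≤ y := by positivity
  have hWm : Measurable W := measurable_scanSum _ _ _ _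
  have hWb : ∀ x, |W x| ≤ (Finset.Icc 1 n).card := abs_scanSum_le hp0 hp1 r a _
  -- The real part of the characteristic function is at least `1 - θ²s/2` because `cos u ≥ 1 -
  -- u²/2`, and its modulus is at most `exp(-yθ²) ≤ 1/(1 + yθ²)`. Letting `θ → 0` compares the
  -- quadratic terms.
  have key : ∀ θ : ℝ, |θ| ≤ Real.pi → (1 - θ ^ 2 * s / 2) * (1 + y * θ ^ 2) ≤ 1 := by
    intro θ hθ
    have h1 := norm_integral_exp_scan_le μ hr ha hθ p n
    change ‖∫ x, Complex.exp ((θ * W x : ℝ) * Complex.I) ∂_‖ ≤ _ at h1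
    have h2 : 1 - θ ^ 2 * s / 2 ≤ ‖∫ x, Complex.exp ((θ * W x : ℝ) * Complex.I)
        ∂(Measure.infinitePi fun _ : ℕ => μ)‖ := by
      refine le_trans ?_ (Complex.re_le_norm _)
      have hi : Integrable (fun x => Complex.exp ((θ * W x : ℝ) * Complex.I))
          (Measure.infinitePi fun _ : ℕ => μ) :=
        integrable_infinitePi_of_bound μ (by fun_prop) (M := 1)
          fun x => (Complex.norm_exp_ofReal_mul_I _).le
      have hre : ∫ x, (Complex.exp ((θ * W x : ℝ) * Complex.I)).re
            ∂(Measure.infinitePi fun _ : ℕ => μ)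
          = (∫ x, Complex.exp ((θ * W x : ℝ) * Complex.I)
            ∂(Measure.infinitePi fun _ : ℕ => μ)).re := integral_re hi
      have hsq : Integrable (fun x => W x ^ 2) (Measure.infinitePi fun _ : ℕ => μ) :=
        integrable_infinitePi_of_bound μ (by fun_prop) (M := ((Finset.Icc 1 n).card : ℝ) ^ 2)
          fun x => by
            rw [norm_pow]
            exact pow_le_pow_left₀ (norm_nonneg _) (hWb x) 2
      rw [← hre]
      calc 1 - θ ^ 2 * s / 2 = ∫ x, (1 - θ ^ 2 / 2 * W x ^ 2)
            ∂(Measure.infinitePi fun _ : ℕ => μ) := by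
            rw [integral_sub (integrable_const _) (hsq.const_mul _), integral_const_mul]
            simp only [hs, integral_const, probReal_univ, smul_eq_mul, mul_one]
            ring
        _ ≤ _ := by
            refine integral_mono ((integrable_const _).sub (hsq.const_mul _)) hi.re fun x => ?_
            have := Real.one_sub_sq_div_two_le_cos (x := θ * W x)
            simp only [Complex.exp_ofReal_mul_I_re]
            rw [mul_pow] at this
            linarith
    have h3 : Real.exp (-(y * θ ^ 2)) * (1 + y * θ ^ 2) ≤ 1 := by
      have h4 := Real.add_one_le_exp (y * θ ^ 2)
      calc _ ≤ Real.exp (-(y * θ ^ 2)) * Real.exp (y * θ ^ 2) :=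
            mul_le_mul_of_nonneg_left (by linarith) (Real.exp_nonneg _)
        _ = 1 := by rw [← Real.exp_add]; simp
    exact (mul_le_mul_of_nonneg_right (h2.trans h1) (by positivity)).trans h3
  by_contra hcon
  push Not at hcon
  set ε := y - s / 2 with hε
  have hε0 : 0 < ε := by linarith
  set K := y * s / 2 with hK
  have hK0 : 0 ≤ K := by positivity
  -- With `t = θ²`, the inequality `key` reads `ε ≤ Kt`. This choice makes `Kt < ε`, and `t ≤ 1`
  -- keeps `θ` below `π`.
  set t := min 1 (ε / (2 * (K + 1))) with ht
  have ht0 : 0 < t := lt_min one_pos (by positivity)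
  have h1 := key (Real.sqrt t) (by
    rw [abs_of_nonneg (Real.sqrt_nonneg _)]
    have : Real.sqrt t ≤ 1 := Real.sqrt_le_one.2 (min_le_left _ _)
    linarith [Real.pi_gt_three])
  rw [Real.sq_sqrt ht0.le] at h1
  have h2 : ε ≤ K * t := by
    have : t * (ε - K * t) ≤ 0 := by
      simp only [hε, hK]; nlinarith
    by_contra h
    push Not at h
    have := mul_pos ht0 (sub_pos.2 h)
    linarith
  have h3 : t ≤ ε / (2 * (K + 1)) := min_le_right _ _
  rw [le_div_iff₀ (by positivity)] at h3
  nlinarith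

end ScanMoments

/-! ### Fourier inversion, Parseval and weighted Cauchy–Schwarz on a shifted lattice. -/

section TrigSum

/-- The trigonometric sum with frequencies in the shifted lattice `ℤ + b` and coefficients `d`. -/
noncomputable def trigSum (S : Finset ℤ) (d : ℤ → ℝ) (b θ : ℝ) : ℂ :=
  ∑ z ∈ S, (d z : ℂ) * Complex.exp ((θ * (z + b) : ℝ) * Complex.I)

theorem continuous_trigSum (S : Finset ℤ) (d : ℤ → ℝ) (b : ℝ) : Continuous (trigSum S d b) := by
  unfold trigSum
  fun_prop

theorem hasDerivAt_trigSum (S : Finset ℤ) (d : ℤ → ℝ) (b θ : ℝ) :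
    HasDerivAt (trigSum S d b) (Complex.I * trigSum S (fun z => (z + b) * d z) b θ) θ := by
  unfold trigSum
  rw [Finset.mul_sum]
  refine HasDerivAt.fun_sum fun z _ => ?_
  have h1 : HasDerivAt (fun θ : ℝ => ((θ * (z + b) : ℝ) : ℂ) * Complex.I)
      ((z + b : ℝ) * Complex.I) θ := by
    have := (((hasDerivAt_id θ).mul_const ((z : ℝ) + b)).ofReal_comp).mul_const Complex.I
    simpa using this
  refine (h1.cexp.const_mul (d z : ℂ)).congr_deriv ?_
  push_cast
  ring

theorem integral_exp_int_mul (k : ℤ) :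
    ∫ θ in (-Real.pi)..Real.pi, Complex.exp ((θ * (k : ℝ) : ℝ) * Complex.I)
      = if k = 0 then (2 * Real.pi : ℂ) else 0 := by
  split_ifs with hk
  · subst hk
    simp
    ring
  · have hc : (k : ℂ) * Complex.I ≠ 0 := mul_ne_zero (by exact_mod_cast hk) Complex.I_ne_zero
    have e : ∀ θ : ℝ, Complex.exp ((θ * (k : ℝ) : ℝ) * Complex.I)
        = Complex.exp ((k : ℂ) * Complex.I * θ) := by
      intro θ; congr 1; push_cast; ring
    simp_rw [e]
    rw [integral_exp_mul_complex hc]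
    have : Complex.exp ((k : ℂ) * Complex.I * (Real.pi : ℂ))
        = Complex.exp ((k : ℂ) * Complex.I * ((-Real.pi : ℝ) : ℂ)) := by
      rw [Complex.exp_eq_exp_iff_exists_int]
      exact ⟨k, by push_cast; ring⟩
    rw [this, sub_self, zero_div]

theorem integral_trigSum_mul_exp_neg (S : Finset ℤ) (d : ℤ → ℝ) (b : ℝ) {z : ℤ} (hz : z ∈ S) :
    ∫ θ in (-Real.pi)..Real.pi, trigSum S d b θ * Complex.exp (-((θ * (z + b) : ℝ) * Complex.I))
      = 2 * Real.pi * d z := by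
  have e : ∀ θ : ℝ, trigSum S d b θ * Complex.exp (-((θ * (z + b) : ℝ) * Complex.I))
      = ∑ w ∈ S, (d w : ℂ) * Complex.exp ((θ * ((w - z : ℤ) : ℝ) : ℝ) * Complex.I) := by
    intro θ
    rw [trigSum, Finset.sum_mul]
    refine Finset.sum_congr rfl fun w _ => ?_
    rw [mul_assoc, ← Complex.exp_add]
    congr 2
    push_cast
    ring
  simp_rw [e]
  rw [intervalIntegral.integral_finsetSum]
  · simp_rw [intervalIntegral.integral_const_mul, integral_exp_int_mul, sub_eq_zero]
    rw [Finset.sum_eq_single z]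
    · simp; ring
    · intro w _ hw
      simp [hw]
    · exact fun h => absurd hz h
  · intro w _
    refine Continuous.intervalIntegrable ?_ _ _
    fun_prop

theorem abs_coeff_le_integral_norm_trigSum (S : Finset ℤ) (d : ℤ → ℝ) (b : ℝ) {z : ℤ}
    (hz : z ∈ S) :
    2 * Real.pi * |d z| ≤ ∫ θ in (-Real.pi)..Real.pi, ‖trigSum S d b θ‖ := by
  have h := integral_trigSum_mul_exp_neg S d b hz
  have h2 := congrArg norm h
  have hp : |Real.pi| = Real.pi := abs_of_pos Real.pi_pos
  rw [norm_mul, norm_mul, Complex.norm_real, Complex.norm_real, Real.norm_eq_abs,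
    Real.norm_eq_abs, hp, RCLike.norm_ofNat] at h2
  rw [← h2]
  refine (intervalIntegral.norm_integral_le_integral_norm (by linarith [Real.pi_pos])).trans
    (le_of_eq ?_)
  congr 1
  funext θ
  have : -(((θ * (z + b) : ℝ) : ℂ) * Complex.I) = ((-(θ * (z + b)) : ℝ) : ℂ) * Complex.I := by
    push_cast; ring
  rw [norm_mul, this, Complex.norm_exp_ofReal_mul_I, mul_one]

/-- Parseval's identity for trigonometric sums. -/
theorem integral_norm_trigSum_sq (S : Finset ℤ) (d : ℤ → ℝ) (b : ℝ) :
    ∫ θ in (-Real.pi)..Real.pi, ‖trigSum S d b θ‖ ^ 2 = 2 * Real.pi * ∑ z ∈ S, d z ^ 2 := by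
  have h : ∀ θ : ℝ, ((‖trigSum S d b θ‖ ^ 2 : ℝ) : ℂ) = ∑ z ∈ S, (d z : ℂ)
      * (trigSum S d b θ * Complex.exp (-((θ * (z + b) : ℝ) * Complex.I))) := by
    intro θ
    rw [Complex.ofReal_pow, ← Complex.mul_conj']
    conv_lhs => rw [trigSum, map_sum, ← trigSum, Finset.mul_sum]
    refine Finset.sum_congr rfl fun z _ => ?_
    rw [map_mul, Complex.conj_ofReal, ← Complex.exp_conj, map_mul, Complex.conj_ofReal,
      Complex.conj_I, mul_neg]
    ring
  have h2 : ((∫ θ in (-Real.pi)..Real.pi, ‖trigSum S d b θ‖ ^ 2 : ℝ) : ℂ)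
      = ((2 * Real.pi * ∑ z ∈ S, d z ^ 2 : ℝ) : ℂ) := by
    rw [← intervalIntegral.integral_ofReal]
    simp_rw [h]
    rw [intervalIntegral.integral_finsetSum]
    · rw [Complex.ofReal_mul, Complex.ofReal_sum, Finset.mul_sum]
      refine Finset.sum_congr rfl fun z hz => ?_
      rw [intervalIntegral.integral_const_mul, integral_trigSum_mul_exp_neg S d b hz]
      push_cast
      ring
    · intro z _
      refine Continuous.intervalIntegrable ?_ _ _
      have := continuous_trigSum S d b
      fun_prop
  exact_mod_cast h2

/-- By the mean value theorem the increment is `h/(1 + u²)` with `|u - y| ≤ 1`, and then `1 + u² ≤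
3(1 + y²)`. This lets a sum of such terms telescope. -/
theorem inv_le_arctan_sub {y h : ℝ} (h0 : 0 < h) (h1 : h ≤ 1) :
    h / (1 + y ^ 2) ≤ 3 * (Real.arctan (y + h) - Real.arctan y) := by
  obtain ⟨u, hu, hu'⟩ := exists_hasDerivAt_eq_slope Real.arctan (fun x => 1 / (1 + x ^ 2))
    (show y < y + h by linarith) Real.continuous_arctan.continuousOn
    fun x _ => Real.hasDerivAt_arctan x
  rw [add_sub_cancel_left, eq_div_iff h0.ne'] at hu'
  rw [← hu']
  have h3 : 1 + u ^ 2 ≤ 3 * (1 + y ^ 2) := by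
    nlinarith [hu.1, hu.2, sq_nonneg (y + (y - u)), sq_nonneg (u - y)]
  rw [div_le_iff₀ (by positivity)]
  have h4 : 1 ≤ 3 * (1 / (1 + u ^ 2)) * (1 + y ^ 2) := by
    rw [mul_one_div, div_mul_eq_mul_div, le_div_iff₀ (by positivity)]
    linarith
  nlinarith

/-- At step `1/√n` each term is at most `3√n` times an increment of `arctan`. Enlarging `S` to an
interval, the increments telescope to at most `π`. -/
theorem sum_inv_one_add_sq_le (S : Finset ℤ) (b : ℝ) {n : ℝ} (hn : 1 ≤ n) :
    ∑ z ∈ S, 1 / (1 + (z + b) ^ 2 / n) ≤ 3 * Real.pi * Real.sqrt n := by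
  have hn0 : 0 < n := by linarith
  have hs0 : 0 < Real.sqrt n := Real.sqrt_pos.2 hn0
  have hs1 : 1 ≤ Real.sqrt n := Real.one_le_sqrt.2 hn
  set F : ℝ → ℝ := fun z => Real.arctan ((z + b) / Real.sqrt n) with hF
  have hmono : Monotone F := fun x y h => Real.arctan_strictMono.monotone
    (div_le_div_of_nonneg_right (by linarith) hs0.le)
  have hterm : ∀ z : ℤ, 1 / (1 + (z + b) ^ 2 / n) ≤ 3 * Real.sqrt n * (F (z + 1) - F z) := by
    intro z
    have := inv_le_arctan_sub (y := (z + b) / Real.sqrt n) (h := 1 / Real.sqrt n)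
      (by positivity) ((div_le_one hs0).2 hs1)
    rw [div_pow, Real.sq_sqrt hn0.le] at this
    have e : (z + b) / Real.sqrt n + 1 / Real.sqrt n = ((z + 1 : ℝ) + b) / Real.sqrt n := by
      rw [← add_div]; ring
    rw [e, div_div, div_le_iff₀ (by positivity)] at this
    rw [div_le_iff₀ (by positivity)]
    simp only [hF]
    calc (1 : ℝ) ≤ _ := this
      _ = _ := by ring
  obtain ⟨N, hN⟩ : ∃ N : ℕ, ∀ z ∈ S, -(N : ℤ) ≤ z ∧ z < N := by
    refine ⟨∑ z ∈ S, (z.natAbs + 1), fun z hz => ?_⟩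
    have := Finset.single_le_sum (f := fun z : ℤ => z.natAbs + 1) (fun _ _ => Nat.zero_le _) hz
    omega
  have hsub : S ⊆ (Finset.range (2 * N)).image fun k : ℕ => (k : ℤ) - N := by
    intro z hz
    have := hN z hz
    exact Finset.mem_image.2 ⟨(z + N).toNat, by rw [Finset.mem_range]; omega, by omega⟩
  calc ∑ z ∈ S, 1 / (1 + (z + b) ^ 2 / n) ≤ ∑ z ∈ S, 3 * Real.sqrt n * (F (z + 1) - F z) :=
        Finset.sum_le_sum fun z _ => hterm z
    _ ≤ ∑ z ∈ (Finset.range (2 * N)).image fun k : ℕ => (k : ℤ) - N,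
          3 * Real.sqrt n * (F (z + 1) - F z) :=
        Finset.sum_le_sum_of_subset_of_nonneg hsub fun z _ _ =>
          mul_nonneg (by positivity) (sub_nonneg.2 (hmono (by linarith)))
    _ = 3 * Real.sqrt n * (F ((2 * N : ℕ) - N) - F ((0 : ℕ) - N)) := by
        rw [Finset.sum_image (fun x _ y _ h => by simpa using h), ← Finset.mul_sum]
        have := Finset.sum_range_sub (fun k : ℕ => F ((k : ℝ) - N)) (2 * N)
        rw [← this]
        congr 1
        refine Finset.sum_congr rfl fun k _ => ?_
        push_cast
        congr 2
        ring
    _ ≤ 3 * Real.sqrt n * Real.pi := by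
        refine mul_le_mul_of_nonneg_left ?_ (by positivity)
        simp only [hF]
        have h1 := Real.arctan_lt_pi_div_two ((((2 * N : ℕ) : ℝ) - N + b) / Real.sqrt n)
        have h2 := Real.neg_pi_div_two_lt_arctan ((((0 : ℕ) : ℝ) - N + b) / Real.sqrt n)
        linarith
    _ = _ := by ring

/-- Cauchy–Schwarz with weight `1 + (z + b)²/n`: the mass essentially sits within `√n` of the
origin, so an `ℓ²` bound and a second moment control the `ℓ¹` norm at the cost of a factor `√n` in
its square. -/
theorem sq_sum_abs_le (S : Finset ℤ) (d : ℤ → ℝ) (b : ℝ) {n : ℝ} (hn : 1 ≤ n) :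
    (∑ z ∈ S, |d z|) ^ 2 ≤ 3 * Real.pi * Real.sqrt n
      * (∑ z ∈ S, d z ^ 2 + (∑ z ∈ S, ((z + b) * d z) ^ 2) / n) := by
  have hn0 : 0 < n := by linarith
  have h := Finset.sum_sq_le_sum_mul_sum_of_sq_le_mul S (r := fun z => |d z|)
    (f := fun z : ℤ => 1 / (1 + (z + b) ^ 2 / n)) (g := fun z : ℤ => (1 + (z + b) ^ 2 / n) * d z ^ 2)
    (fun z _ => by positivity) (fun z _ => by positivity) fun z _ => by
      rw [sq_abs]
      have : (1 + ((z : ℝ) + b) ^ 2 / n) ≠ 0 := by positivity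
      exact le_of_eq (by field_simp)
  refine h.trans ?_
  have e : ∑ z ∈ S, (1 + ((z : ℝ) + b) ^ 2 / n) * d z ^ 2
      = ∑ z ∈ S, d z ^ 2 + (∑ z ∈ S, ((z + b) * d z) ^ 2) / n := by
    rw [Finset.sum_div, ← Finset.sum_add_distrib]
    refine Finset.sum_congr rfl fun z _ => ?_
    ring
  rw [e]
  refine mul_le_mul_of_nonneg_right (sum_inv_one_add_sq_le S b hn) ?_
  rw [← e]
  exact Finset.sum_nonneg fun z _ => by positivity

theorem intervalIntegral_exp_neg_mul_sq_le {c : ℝ} (hc : 0 < c) :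
    ∫ θ in (-Real.pi)..Real.pi, Real.exp (-c * θ ^ 2) ≤ Real.sqrt (Real.pi / c) := by
  rw [intervalIntegral.integral_of_le (by linarith [Real.pi_pos]), ← integral_gaussian c]
  exact setIntegral_le_integral (integrable_exp_neg_mul_sq hc)
    (Filter.Eventually.of_forall fun θ => (Real.exp_pos _).le)

/-- The term `y²/2` of `exp y` at `y = cx²/2` is `c²x⁴/8`, which explains `8/c²`; the lower powers
are absorbed in `4(1 + x⁴)`. -/
theorem poly_le_exp {c x : ℝ} (hc : 0 < c) :
    x ^ 4 + x ^ 3 + x ^ 2 + x ≤ 4 * (1 + 8 / c ^ 2) * Real.exp (c * x ^ 2 / 2) := by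
  have h1 := Real.quadratic_le_exp_of_nonneg (show 0 ≤ c * x ^ 2 / 2 by positivity)
  have h2 : 1 ≤ Real.exp (c * x ^ 2 / 2) := Real.one_le_exp (by positivity)
  have h3 : x ^ 4 ≤ 8 / c ^ 2 * Real.exp (c * x ^ 2 / 2) := by
    rw [div_mul_eq_mul_div, le_div_iff₀ (by positivity)]
    have : 0 ≤ c * x ^ 2 := by positivity
    nlinarith
  have h4 : x ^ 4 + x ^ 3 + x ^ 2 + x ≤ 4 * (1 + x ^ 4) := by
    nlinarith [sq_nonneg (x ^ 2 - 1), sq_nonneg (x - 1), sq_nonneg (x ^ 2 - x), sq_nonneg (x ^ 2)]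
  nlinarith

end TrigSum

/-! ### From the approximate differential equation to coefficient bounds. -/

section Comparison

/-- A function that nearly solves the differential equation `ψ' = -s θ ψ` with `ψ 0 = 0` is small. -/
theorem norm_le_of_norm_deriv_add_le {ψ ψ' : ℝ → ℂ} {R c n s K : ℝ}
    (hcs : 2 * (c * n) ≤ s) (hn : 0 ≤ n) (hK : 0 ≤ K) (hψ : ∀ θ, HasDerivAt ψ (ψ' θ) θ)
    (h0 : ψ 0 = 0)
    (h : ∀ θ, |θ| ≤ R → ‖ψ' θ + s * θ * ψ θ‖
      ≤ K * (n * θ ^ 2 + |θ|) * Real.exp (-(c * n * θ ^ 2))) {θ : ℝ} (hθ : |θ| ≤ R) :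
    ‖ψ θ‖ ≤ K * (n * |θ| ^ 3 + θ ^ 2) * Real.exp (-(c * n * θ ^ 2)) := by
  -- The integrating factor `exp(su²/2)` turns the equation into a bound on a derivative. As `s/2 ≥
  -- cn`, that bound increases with `|u|`, so the mean value inequality may use its value at `θ`.
  have hd : ∀ u : ℝ, HasDerivAt (fun u : ℝ => ψ u * Complex.exp ((s * u ^ 2 / 2 : ℝ)))
      ((ψ' u + s * u * ψ u) * Complex.exp ((s * u ^ 2 / 2 : ℝ))) u := by
    intro u
    have h1 : HasDerivAt (fun u : ℝ => s * u ^ 2 / 2) (s * u) u := by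
      have := ((hasDerivAt_pow 2 u).const_mul s).div_const 2
      refine this.congr_deriv ?_
      push_cast
      ring
    refine ((hψ u).mul h1.ofReal_comp.cexp).congr_deriv ?_
    push_cast
    ring
  have hexp : ∀ y : ℝ, ‖Complex.exp (y : ℂ)‖ = Real.exp y := fun y => by
    rw [Complex.norm_exp, Complex.ofReal_re]
  have hmv := (convex_Icc (-|θ|) |θ|).norm_image_sub_le_of_norm_hasDerivWithin_le
    (C := K * (n * θ ^ 2 + |θ|) * Real.exp ((s / 2 - c * n) * θ ^ 2))
    (f := fun u : ℝ => ψ u * Complex.exp ((s * u ^ 2 / 2 : ℝ)))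
    (fun u _ => (hd u).hasDerivWithinAt) ?_ (x := 0) (y := θ) (by simp)
    (Set.mem_Icc.2 ⟨neg_abs_le θ, le_abs_self θ⟩)
  · simp only [h0, zero_mul, sub_zero, norm_mul, hexp, Real.norm_eq_abs] at hmv
    have h2 : ‖ψ θ‖ = ‖ψ θ‖ * Real.exp (s * θ ^ 2 / 2) * Real.exp (-(s * θ ^ 2 / 2)) := by
      rw [mul_assoc, ← Real.exp_add]; simp
    rw [h2]
    refine (mul_le_mul_of_nonneg_right hmv (Real.exp_nonneg _)).trans (le_of_eq ?_)
    have h3 : Real.exp (-(c * n * θ ^ 2))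
        = Real.exp ((s / 2 - c * n) * θ ^ 2) * Real.exp (-(s * θ ^ 2 / 2)) := by
      rw [← Real.exp_add]; congr 1; ring
    rw [h3, ← sq_abs θ]
    ring
  · intro u hu
    have hu' : |u| ≤ |θ| := abs_le.2 hu
    have hu2 : u ^ 2 ≤ θ ^ 2 := sq_le_sq.2 hu'
    rw [norm_mul, hexp]
    refine (mul_le_mul_of_nonneg_right (h u (hu'.trans hθ)) (Real.exp_nonneg _)).trans ?_
    rw [mul_assoc, ← Real.exp_add]
    refine mul_le_mul ?_ (Real.exp_le_exp.2 ?_) (Real.exp_nonneg _) (by positivity)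
    · exact mul_le_mul_of_nonneg_left (add_le_add (mul_le_mul_of_nonneg_left hu2 hn) hu') hK
    · have : 0 ≤ s / 2 - c * n := by linarith
      nlinarith

/-- Gaussian bounds, at the scale `1 / √n`, for a function that nearly solves `ψ' = -s θ ψ`, and for
its derivative. -/
theorem norm_le_gaussian_of_norm_deriv_add_le {ψ ψ' : ℝ → ℂ} {R c n s K : ℝ} (hc : 0 < c)
    (hn : 1 ≤ n) (hcs : 2 * (c * n) ≤ s) (hsK : s ≤ K * n)
    (hψ : ∀ θ, HasDerivAt ψ (ψ' θ) θ) (h0 : ψ 0 = 0)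
    (h : ∀ θ, |θ| ≤ R → ‖ψ' θ + s * θ * ψ θ‖
      ≤ K * (n * θ ^ 2 + |θ|) * Real.exp (-(c * n * θ ^ 2))) {θ : ℝ} (hθ : |θ| ≤ R) :
    ‖ψ θ‖ ≤ (K ^ 2 + K) * (4 * (1 + 8 / c ^ 2)) / Real.sqrt n * Real.exp (-(c * n / 2) * θ ^ 2) ∧
    ‖ψ' θ‖ ≤ (K ^ 2 + K) * (4 * (1 + 8 / c ^ 2)) * Real.exp (-(c * n / 2) * θ ^ 2) := by
  have hn0 : 0 < n := by linarith
  have hs0 : 0 ≤ s := le_trans (by positivity) hcs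
  have hK : 0 ≤ K := by
    by_contra hneg
    push Not at hneg
    nlinarith
  have hq0 : 0 < Real.sqrt n := Real.sqrt_pos.2 hn0
  have hq1 : 1 ≤ Real.sqrt n := Real.one_le_sqrt.2 hn
  set q := Real.sqrt n with hq
  have hqn : q ^ 2 = n := Real.sq_sqrt hn0.le
  set x := q * |θ| with hx
  have hx0 : 0 ≤ x := by positivity
  have hx2 : x ^ 2 = n * θ ^ 2 := by rw [hx, mul_pow, hqn, sq_abs]
  set e := Real.exp (-(c * n * θ ^ 2)) with he
  -- Half of the Gaussian exponent is spent on absorbing all powers of `x = √n |θ|` at once.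
  have hpoly : (x ^ 4 + x ^ 3 + x ^ 2 + x) * e
      ≤ 4 * (1 + 8 / c ^ 2) * Real.exp (-(c * n / 2) * θ ^ 2) := by
    refine (mul_le_mul_of_nonneg_right (poly_le_exp hc) (Real.exp_nonneg _)).trans (le_of_eq ?_)
    rw [mul_assoc, ← Real.exp_add, hx2]
    congr 2
    ring
  have he0 : 0 ≤ e := Real.exp_nonneg _
  have hψb := norm_le_of_norm_deriv_add_le hcs hn0.le hK hψ h0 h hθ
  have h1 : n * |θ| ^ 3 + θ ^ 2 ≤ (x ^ 3 + x ^ 2) / q := by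
    rw [le_div_iff₀ hq0]
    have e1 : (n * |θ| ^ 3 + θ ^ 2) * q = x ^ 3 + x ^ 2 / q := by
      rw [hx, ← hqn, ← sq_abs θ]
      field_simp
    rw [e1]
    have : x ^ 2 / q ≤ x ^ 2 := div_le_self (by positivity) hq1
    linarith
  have h2 : ‖ψ θ‖ ≤ K * ((x ^ 3 + x ^ 2) / q) * e :=
    hψb.trans (mul_le_mul_of_nonneg_right (mul_le_mul_of_nonneg_left h1 hK) he0)
  have hθx : |θ| ≤ x := le_mul_of_one_le_left (abs_nonneg θ) hq1
  set E := Real.exp (-(c * n / 2) * θ ^ 2) with hE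
  have hpoly' : (x ^ 3 + x ^ 2) * e ≤ 4 * (1 + 8 / c ^ 2) * E := by
    refine le_trans (mul_le_mul_of_nonneg_right ?_ he0) hpoly
    have : 0 ≤ x ^ 4 := by positivity
    linarith
  have hG : 0 ≤ 4 * (1 + 8 / c ^ 2) * E := by positivity
  constructor
  · calc ‖ψ θ‖ ≤ K * ((x ^ 3 + x ^ 2) / q) * e := h2
      _ = K * ((x ^ 3 + x ^ 2) * e) / q := by ring
      _ ≤ (K ^ 2 + K) * (4 * (1 + 8 / c ^ 2) * E) / q := by
        refine div_le_div_of_nonneg_right ?_ hq0.le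
        exact mul_le_mul (by nlinarith) hpoly' (by positivity) (by positivity)
      _ = _ := by ring
  · have h3 : ‖ψ' θ‖ ≤ K * (n * θ ^ 2 + |θ|) * e + s * |θ| * ‖ψ θ‖ := by
      have := norm_sub_le (ψ' θ + s * θ * ψ θ) (s * θ * ψ θ)
      rw [add_sub_cancel_right] at this
      refine this.trans (add_le_add (h θ hθ) (le_of_eq ?_))
      rw [norm_mul, norm_mul, Complex.norm_real, Complex.norm_real, Real.norm_of_nonneg hs0,
        Real.norm_eq_abs]
    have h4 : K * (n * θ ^ 2 + |θ|) * e ≤ K * ((x ^ 2 + x) * e) := by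
      rw [← hx2, mul_assoc]
      exact mul_le_mul_of_nonneg_left (mul_le_mul_of_nonneg_right (by linarith) he0) hK
    -- The factor `s|θ| ≤ Kn|θ| = K√n x` cancels the gain `1/√n` in the bound for `ψ`, so `ψ'` is
    -- only bounded, and `K²` appears.
    have h5 : s * |θ| * ‖ψ θ‖ ≤ K ^ 2 * ((x ^ 4 + x ^ 3) * e) := by
      calc s * |θ| * ‖ψ θ‖ ≤ (K * n) * |θ| * (K * ((x ^ 3 + x ^ 2) / q) * e) :=
            mul_le_mul (mul_le_mul_of_nonneg_right hsK (abs_nonneg _)) h2 (norm_nonneg _)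
              (by positivity)
        _ = K ^ 2 * ((x ^ 4 + x ^ 3) * e) := by
            rw [← hqn, hx]
            field_simp
    have h6 : (x ^ 2 + x) * e ≤ 4 * (1 + 8 / c ^ 2) * E := by
      refine le_trans (mul_le_mul_of_nonneg_right ?_ he0) hpoly
      have : 0 ≤ x ^ 4 + x ^ 3 := by positivity
      linarith
    have h7 : (x ^ 4 + x ^ 3) * e ≤ 4 * (1 + 8 / c ^ 2) * E := by
      refine le_trans (mul_le_mul_of_nonneg_right ?_ he0) hpoly
      have : 0 ≤ x ^ 2 + x := by positivity
      linarith
    have h8 := mul_le_mul_of_nonneg_left h6 hK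
    have h9 := mul_le_mul_of_nonneg_left h7 (sq_nonneg K)
    calc ‖ψ' θ‖ ≤ K * (4 * (1 + 8 / c ^ 2) * E) + K ^ 2 * (4 * (1 + 8 / c ^ 2) * E) := by linarith
      _ = _ := by ring

/-- Fourier inversion: the width of the Gaussian supplies a second factor `n^{-1/2}`. -/
theorem abs_coeff_le_of_norm_trigSum_le {S : Finset ℤ} {d : ℤ → ℝ} {b G c n : ℝ} (hc : 0 < c)
    (hn : 0 < n) (hG : 0 ≤ G)
    (h : ∀ θ, |θ| ≤ Real.pi → ‖trigSum S d b θ‖ ≤ G / Real.sqrt n * Real.exp (-(c * n) * θ ^ 2))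
    {z : ℤ} (hz : z ∈ S) : |d z| ≤ G * Real.sqrt (Real.pi / c) / n := by
  have hπ := Real.pi_gt_three
  have h1 := abs_coeff_le_integral_norm_trigSum S d b hz
  have h2 : ∫ θ in (-Real.pi)..Real.pi, ‖trigSum S d b θ‖
      ≤ ∫ θ in (-Real.pi)..Real.pi, G / Real.sqrt n * Real.exp (-(c * n) * θ ^ 2) := by
    refine intervalIntegral.integral_mono_on (by linarith) ?_ ?_ fun θ hθ => h θ (abs_le.2 hθ)
    · exact (continuous_trigSum S d b).norm.intervalIntegrable _ _
    · exact Continuous.intervalIntegrable (by fun_prop) _ _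
  rw [intervalIntegral.integral_const_mul] at h2
  have h3 := intervalIntegral_exp_neg_mul_sq_le (c := c * n) (by positivity)
  have hq0 : 0 < Real.sqrt n := Real.sqrt_pos.2 hn
  have h4 : G / Real.sqrt n * Real.sqrt (Real.pi / (c * n)) = G * Real.sqrt (Real.pi / c) / n := by
    rw [← div_div, Real.sqrt_div (by positivity)]
    nth_rewrite 3 [← Real.mul_self_sqrt hn.le]
    field_simp
  have h5 := mul_le_mul_of_nonneg_left h3 (show 0 ≤ G / Real.sqrt n by positivity)
  rw [h4] at h5
  have h6 : |d z| ≤ 2 * Real.pi * |d z| := by nlinarith [abs_nonneg (d z)]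
  linarith

/-- Parseval. After squaring, one of the two exponentials is bounded by `1`, which only affects the
constant. -/
theorem sum_sq_coeff_le_of_norm_trigSum_le {S : Finset ℤ} {d : ℤ → ℝ} {b G c n : ℝ} (hc : 0 < c)
    (hn : 0 < n)
    (h : ∀ θ, |θ| ≤ Real.pi → ‖trigSum S d b θ‖ ≤ G * Real.exp (-(c * n) * θ ^ 2)) :
    ∑ z ∈ S, d z ^ 2 ≤ G ^ 2 * (Real.sqrt (Real.pi / c) / Real.sqrt n) := by
  have hπ := Real.pi_gt_three
  have h1 := integral_norm_trigSum_sq S d b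
  have h2 : ∫ θ in (-Real.pi)..Real.pi, ‖trigSum S d b θ‖ ^ 2
      ≤ ∫ θ in (-Real.pi)..Real.pi, G ^ 2 * Real.exp (-(c * n) * θ ^ 2) := by
    refine intervalIntegral.integral_mono_on (by linarith) ?_ ?_ fun θ hθ => ?_
    · exact ((continuous_trigSum S d b).norm.pow 2).intervalIntegrable _ _
    · exact Continuous.intervalIntegrable (by fun_prop) _ _
    · have h3 := pow_le_pow_left₀ (norm_nonneg _) (h θ (abs_le.2 hθ)) 2
      have h4 : Real.exp (-(c * n) * θ ^ 2) ≤ 1 := Real.exp_le_one_iff.2 (by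
        have : 0 ≤ c * n * θ ^ 2 := by positivity
        linarith)
      refine h3.trans ?_
      rw [mul_pow, sq (Real.exp _)]
      exact mul_le_mul_of_nonneg_left (mul_le_of_le_one_left (Real.exp_nonneg _) h4) (sq_nonneg _)
  rw [intervalIntegral.integral_const_mul, h1] at h2
  have h3 := intervalIntegral_exp_neg_mul_sq_le (c := c * n) (by positivity)
  rw [← div_div, Real.sqrt_div (by positivity)] at h3
  have h5 := mul_le_mul_of_nonneg_left h3 (sq_nonneg G)
  have h6 : 0 ≤ ∑ z ∈ S, d z ^ 2 := Finset.sum_nonneg fun z _ => sq_nonneg _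
  nlinarith

/-- If a trigonometric sum with vanishing total mass nearly satisfies the differential equation of a
Gaussian characteristic function, then its coefficients are small. -/
theorem exists_coeff_bounds {c K : ℝ} (hc : 0 < c) (hK : 0 ≤ K) :
    ∃ C : ℝ, 0 ≤ C ∧ ∀ (S : Finset ℤ) (d : ℤ → ℝ) (b n s : ℝ), 1 ≤ n → 2 * (c * n) ≤ s →
      s ≤ K * n → ∑ z ∈ S, d z = 0 →
      (∀ θ, |θ| ≤ Real.pi →
        ‖Complex.I * trigSum S (fun z => (z + b) * d z) b θ + s * θ * trigSum S d b θ‖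
          ≤ K * (n * θ ^ 2 + |θ|) * Real.exp (-(c * n * θ ^ 2))) →
      (∀ z ∈ S, |d z| ≤ C / n) ∧ ∑ z ∈ S, |d z| ≤ C / Real.sqrt n := by
  set G := (K ^ 2 + K) * (4 * (1 + 8 / c ^ 2)) with hG
  have hG0 : 0 ≤ G := by positivity
  set D := Real.sqrt (Real.pi / (c / 2)) with hD
  have hD0 : 0 ≤ D := Real.sqrt_nonneg _
  refine ⟨G * D + Real.sqrt (6 * Real.pi * (G ^ 2 * D)), by positivity,
    fun S d b n s hn hcs hsK hd h => ?_⟩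
  have hn0 : 0 < n := by linarith
  have hq0 : 0 < Real.sqrt n := Real.sqrt_pos.2 hn0
  have hψ0 : trigSum S d b 0 = 0 := by
    simp only [trigSum, zero_mul, Complex.ofReal_zero, Complex.exp_zero, mul_one]
    exact_mod_cast hd
  have hb := fun θ hθ => norm_le_gaussian_of_norm_deriv_add_le (θ := θ) hc hn hcs hsK
    (hasDerivAt_trigSum S d b) hψ0 h hθ
  have hc2 : 0 < c / 2 := by positivity
  have hcn : c * n / 2 = c / 2 * n := by ring
  constructor
  · intro z hz
    have := abs_coeff_le_of_norm_trigSum_le hc2 hn0 hG0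
      (fun θ hθ => hcn ▸ (hb θ hθ).1) hz
    refine this.trans (div_le_div_of_nonneg_right ?_ hn0.le)
    exact le_add_of_nonneg_right (Real.sqrt_nonneg _)
  · have h1 := sum_sq_coeff_le_of_norm_trigSum_le hc2 hn0 (fun θ hθ => hcn ▸ (hb θ hθ).1)
    have h2 := sum_sq_coeff_le_of_norm_trigSum_le (S := S) (d := fun z => (z + b) * d z) (b := b)
      (G := G) hc2 hn0 (fun θ hθ => by
        have := (hb θ hθ).2
        rw [norm_mul, Complex.norm_I, one_mul] at this
        exact hcn ▸ this)
    have h3 := sq_sum_abs_le S d b hn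
    -- Parseval for `ψ` gives order `n^{-3/2}`, and for `ψ'` order `n^{-1/2}`, which is divided by
    -- `n`. The weights contribute `√n`, so the square of the sum is `O(1/n)`.
    have h4 : (∑ z ∈ S, |d z|) ^ 2 ≤ 6 * Real.pi * (G ^ 2 * D) / n := by
      refine h3.trans ?_
      have h5 : ∑ z ∈ S, d z ^ 2 + (∑ z ∈ S, ((z + b) * d z) ^ 2) / n
          ≤ (G / Real.sqrt n) ^ 2 * (D / Real.sqrt n) + G ^ 2 * (D / Real.sqrt n) / n :=
        add_le_add h1 (div_le_div_of_nonneg_right h2 hn0.le)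
      refine (mul_le_mul_of_nonneg_left h5 (by positivity)).trans (le_of_eq ?_)
      rw [div_pow, Real.sq_sqrt hn0.le]
      field_simp
      ring
    have h6 := Real.abs_le_sqrt h4
    rw [abs_of_nonneg (Finset.sum_nonneg fun z _ => abs_nonneg _),
      Real.sqrt_div (by positivity)] at h6
    refine h6.trans (div_le_div_of_nonneg_right ?_ hq0.le)
    exact le_add_of_nonneg_left (by positivity)

end Comparison

/-! ### Distances between measures on a common lattice. -/

section Lattice

/-- Integration against a probability measure carried by finitely many points of `ℤ + b`. -/
theorem integral_eq_sum_lattice {E : Type*} [NormedAddCommGroup E] [NormedSpace ℝ E]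
    [CompleteSpace E] {P : Measure ℝ}
    [IsFiniteMeasure P] {S : Finset ℤ} {b : ℝ} (hP : ∀ᵐ x ∂P, ∃ z ∈ S, x = (z : ℝ) + b)
    (f : ℝ → E) : ∫ x, f x ∂P = ∑ z ∈ S, P.real {(z : ℝ) + b} • f (z + b) := by
  have h : f =ᵐ[P] fun x => ∑ z ∈ S, Set.indicator {(z : ℝ) + b} (fun _ => f (z + b)) x := by
    filter_upwards [hP] with x hx
    obtain ⟨z, hz, rfl⟩ := hx
    rw [Finset.sum_eq_single z]
    · simp
    · intro w _ hw
      refine Set.indicator_of_notMem ?_ _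
      simpa using hw.symm
    · exact fun h => absurd hz h
  rw [integral_congr_ae h, integral_finsetSum]
  · refine Finset.sum_congr rfl fun z _ => ?_
    rw [integral_indicator_const _ (measurableSet_singleton _)]
  · intro z _
    exact (integrable_const _).indicator (measurableSet_singleton _)

theorem trigSum_eq_integral {P : Measure ℝ} [IsFiniteMeasure P] {S : Finset ℤ} {b : ℝ}
    (hP : ∀ᵐ x ∂P, ∃ z ∈ S, x = (z : ℝ) + b) (θ : ℝ) :
    trigSum S (fun z => P.real {(z : ℝ) + b}) b θ
      = ∫ x, Complex.exp ((θ * x : ℝ) * Complex.I) ∂P := by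
  rw [integral_eq_sum_lattice hP]
  rfl

theorem trigSum_mul_eq_integral {P : Measure ℝ} [IsFiniteMeasure P] {S : Finset ℤ} {b : ℝ}
    (hP : ∀ᵐ x ∂P, ∃ z ∈ S, x = (z : ℝ) + b) (θ : ℝ) :
    trigSum S (fun z => (z + b) * P.real {(z : ℝ) + b}) b θ
      = ∫ x, (x : ℂ) * Complex.exp ((θ * x : ℝ) * Complex.I) ∂P := by
  rw [integral_eq_sum_lattice hP]
  refine Finset.sum_congr rfl fun z _ => ?_
  rw [Complex.real_smul]
  push_cast
  ring

theorem trigSum_sub (S : Finset ℤ) (d e : ℤ → ℝ) (b θ : ℝ) :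
    trigSum S (fun z => d z - e z) b θ = trigSum S d b θ - trigSum S e b θ := by
  simp only [trigSum]
  rw [← Finset.sum_sub_distrib]
  refine Finset.sum_congr rfl fun z _ => ?_
  push_cast
  ring

theorem sum_lattice_eq_one {P : Measure ℝ} [IsProbabilityMeasure P] {S : Finset ℤ} {b : ℝ}
    (hP : ∀ᵐ x ∂P, ∃ z ∈ S, x = (z : ℝ) + b) : ∑ z ∈ S, P.real {(z : ℝ) + b} = 1 := by
  have := integral_eq_sum_lattice hP (fun _ => (1 : ℝ))
  simpa using this.symm

theorem measureReal_eq_sum_lattice {P : Measure ℝ} [IsFiniteMeasure P] {S : Finset ℤ} {b : ℝ}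
    (hP : ∀ᵐ x ∂P, ∃ z ∈ S, x = (z : ℝ) + b) {A : Set ℝ} (hA : MeasurableSet A) :
    P.real A = ∑ z ∈ S, P.real {(z : ℝ) + b} * A.indicator (fun _ => 1) ((z : ℝ) + b) := by
  have := integral_eq_sum_lattice hP (A.indicator fun _ => (1 : ℝ))
  rw [integral_indicator_const _ hA] at this
  simpa using this

variable {P Q : Measure ℝ} [IsFiniteMeasure P] [IsFiniteMeasure Q] {S : Finset ℤ} {b : ℝ}

theorem dTV_le_sum_lattice (hP : ∀ᵐ x ∂P, ∃ z ∈ S, x = (z : ℝ) + b)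
    (hQ : ∀ᵐ x ∂Q, ∃ z ∈ S, x = (z : ℝ) + b) :
    dTV P Q ≤ ∑ z ∈ S, |P.real {(z : ℝ) + b} - Q.real {(z : ℝ) + b}| := by
  refine Real.iSup_le (fun A => ?_) (Finset.sum_nonneg fun z _ => abs_nonneg _)
  rw [measureReal_eq_sum_lattice hP A.2, measureReal_eq_sum_lattice hQ A.2,
    ← Finset.sum_sub_distrib]
  refine (Finset.abs_sum_le_sum_abs _ _).trans (Finset.sum_le_sum fun z _ => ?_)
  rw [← sub_mul, abs_mul]
  refine mul_le_of_le_one_right (abs_nonneg _) ?_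
  by_cases h : (z : ℝ) + b ∈ A.1 <;> simp [h]

/-- A half-open interval of length one contains just one point of `ℤ + b`, the one with `z = ⌈x -
b⌉`, so the local metric only compares point masses. -/
theorem dLoc_le_of_lattice (hP : ∀ᵐ x ∂P, ∃ z ∈ S, x = (z : ℝ) + b)
    (hQ : ∀ᵐ x ∂Q, ∃ z ∈ S, x = (z : ℝ) + b) {D : ℝ} (hD : 0 ≤ D)
    (h : ∀ z ∈ S, |P.real {(z : ℝ) + b} - Q.real {(z : ℝ) + b}| ≤ D) :
    dLoc P Q ≤ D := by
  refine Real.iSup_le (fun x => ?_) hD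
  have hind : ∀ z : ℤ, z ≠ ⌈x - b⌉ →
      (Set.Ico x (x + 1)).indicator (fun _ => (1 : ℝ)) ((z : ℝ) + b) = 0 := by
    intro z hz
    refine Set.indicator_of_notMem (fun hmem => hz ?_) _
    symm
    rw [Int.ceil_eq_iff]
    constructor <;> linarith [hmem.1, hmem.2]
  rw [measureReal_eq_sum_lattice hP measurableSet_Ico, measureReal_eq_sum_lattice hQ
    measurableSet_Ico, ← Finset.sum_sub_distrib]
  by_cases hz : ⌈x - b⌉ ∈ S
  · rw [Finset.sum_eq_single_of_mem _ hz fun z _ hne => by rw [hind z hne]; ring]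
    rw [← sub_mul, abs_mul]
    refine (mul_le_of_le_one_right (abs_nonneg _) ?_).trans (h _ hz)
    by_cases h : ((⌈x - b⌉ : ℤ) : ℝ) + b ∈ Set.Ico x (x + 1) <;> simp [h]
  · rw [Finset.sum_eq_zero fun z hzS => by
      rw [hind z fun h => hz (h ▸ hzS)]; ring]
    simpa using hD

end Lattice

/-! ### Characteristic function of the centered binomial distribution. -/

section CenteredBinomial

instance isProbabilityMeasure_centeredBinomial (m : ℕ) (q : unitInterval) :
    IsProbabilityMeasure (centeredBinomial m q) :=
  Measure.isProbabilityMeasure_map (by fun_prop)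

theorem ae_centeredBinomial (m : ℕ) (q : unitInterval) :
    ∀ᵐ x ∂(centeredBinomial m q), ∃ k : ℕ, k ≤ m ∧ x = (k : ℝ) - m * (q : ℝ) := by
  have h : ∀ᵐ k ∂(binomial m q), k ≤ m :=
    ae_le_of_hasLaw_binomial (X := id) (P := binomial m q) HasLaw.id
  have hfin : MeasurableSet {x : ℝ | ∃ k : ℕ, k ≤ m ∧ x = (k : ℝ) - m * (q : ℝ)} := by
    have : {x : ℝ | ∃ k : ℕ, k ≤ m ∧ x = (k : ℝ) - m * (q : ℝ)}
        = ⋃ k ∈ Finset.range (m + 1), {(k : ℝ) - m * (q : ℝ)} := by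
      ext x; simp
    rw [this]
    exact Finset.measurableSet_biUnion _ fun k _ => measurableSet_singleton _
  unfold centeredBinomial
  rw [ae_map_iff (by fun_prop) hfin]
  filter_upwards [h] with k hk
  exact ⟨k, hk, rfl⟩

/-- The characteristic function of a centered Bernoulli variable. -/
noncomputable def bernoulliChar (q θ : ℝ) : ℂ :=
  (q : ℂ) * Complex.exp ((θ * (1 - q) : ℝ) * Complex.I)
    + (1 - q : ℝ) * Complex.exp ((θ * (-q) : ℝ) * Complex.I)

theorem integral_exp_centeredBinomial (m : ℕ) (q : unitInterval) (θ : ℝ) :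
    ∫ x, Complex.exp ((θ * x : ℝ) * Complex.I) ∂(centeredBinomial m q)
      = bernoulliChar q θ ^ m := by
  unfold centeredBinomial
  rw [integral_map (by fun_prop) (by fun_prop), integral_binomial, bernoulliChar, add_pow]
  have : Finset.Iic m = Finset.range (m + 1) := by
    ext k; simp
  rw [this]
  refine Finset.sum_congr rfl fun k hk => ?_
  have hkm : k ≤ m := by simpa using hk
  rw [mul_pow, mul_pow, ← Complex.exp_nat_mul, ← Complex.exp_nat_mul, Complex.real_smul]
  have e : Complex.exp ((θ * ((k : ℝ) - m * (q : ℝ)) : ℝ) * Complex.I)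
      = Complex.exp ((k : ℂ) * ((θ * (1 - q) : ℝ) * Complex.I))
        * Complex.exp (((m - k : ℕ) : ℂ) * ((θ * (-q) : ℝ) * Complex.I)) := by
    rw [← Complex.exp_add, Nat.cast_sub hkm]
    congr 1
    push_cast
    ring
  rw [e]
  push_cast
  ring

theorem hasDerivAt_bernoulliChar (q θ : ℝ) :
    HasDerivAt (bernoulliChar q) (Complex.I * (q * (1 - q) : ℝ)
      * (Complex.exp ((θ * (-q) : ℝ) * Complex.I) * (Complex.exp (θ * Complex.I) - 1))) θ := by
  have hd : ∀ y : ℝ, HasDerivAt (fun θ : ℝ => Complex.exp ((θ * y : ℝ) * Complex.I))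
      (Complex.exp ((θ * y : ℝ) * Complex.I) * (y * Complex.I)) θ := by
    intro y
    have h1 : HasDerivAt (fun θ : ℝ => ((θ * y : ℝ) : ℂ) * Complex.I) (y * Complex.I) θ := by
      have := (((hasDerivAt_id θ).mul_const y).ofReal_comp).mul_const Complex.I
      simpa using this
    exact h1.cexp
  have e : Complex.exp ((θ * (1 - q) : ℝ) * Complex.I)
      = Complex.exp ((θ * (-q) : ℝ) * Complex.I) * Complex.exp (θ * Complex.I) := by
    rw [← Complex.exp_add]; congr 1; push_cast; ring
  unfold bernoulliChar
  refine (((hd (1 - q)).const_mul (q : ℂ)).add ((hd (-q)).const_mul ((1 - q : ℝ) : ℂ))).congr_deriv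
    ?_
  rw [e]
  push_cast
  ring

theorem bernoulliChar_eq (q θ : ℝ) : bernoulliChar q θ = Complex.exp ((θ * (-q) : ℝ) * Complex.I)
    * (1 + q * (Complex.exp (θ * Complex.I) - 1)) := by
  have e : Complex.exp ((θ * (1 - q) : ℝ) * Complex.I)
      = Complex.exp ((θ * (-q) : ℝ) * Complex.I) * Complex.exp (θ * Complex.I) := by
    rw [← Complex.exp_add]; congr 1; push_cast; ring
  rw [bernoulliChar, e]
  push_cast
  ring

theorem norm_bernoulliChar_le {q θ : ℝ} (h0 : 0 ≤ q) (h1 : q ≤ 1) (hθ : |θ| ≤ Real.pi) :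
    ‖bernoulliChar q θ‖ ≤ Real.exp (-(q * (1 - q) * (2 / Real.pi ^ 2) * θ ^ 2)) := by
  rw [bernoulliChar_eq, norm_mul, Complex.norm_exp_ofReal_mul_I, one_mul]
  refine (norm_one_add_mul_exp_sub_one_le h0 h1).trans ?_
  refine (Real.one_sub_le_exp_neg _).trans (Real.exp_le_exp.2 (neg_le_neg ?_))
  rw [mul_assoc]
  refine mul_le_mul_of_nonneg_left ?_ (mul_nonneg h0 (by linarith))
  linarith [Real.cos_le_one_sub_mul_cos_sq hθ]

/-- To first order the derivative is `-vθ` with `v = q(1-q)`, and the characteristic function is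
`1`. The remaining bracket is at most `2θ²`, and it is multiplied by `v ≤ 1/4`. -/
theorem norm_deriv_bernoulliChar_add_le {q : ℝ} (θ : ℝ) (h0 : 0 ≤ q) (h1 : q ≤ 1) :
    ‖Complex.I * (q * (1 - q) : ℝ)
      * (Complex.exp ((θ * (-q) : ℝ) * Complex.I) * (Complex.exp (θ * Complex.I) - 1))
      + (q * (1 - q) : ℝ) * θ * bernoulliChar q θ‖ ≤ θ ^ 2 := by
  have hv0 : 0 ≤ q * (1 - q) := mul_nonneg h0 (by linarith)
  have hv1 : q * (1 - q) ≤ 1 / 4 := by nlinarith [sq_nonneg (q - 1 / 2)]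
  have e : Complex.I * (q * (1 - q) : ℝ)
      * (Complex.exp ((θ * (-q) : ℝ) * Complex.I) * (Complex.exp (θ * Complex.I) - 1))
      + (q * (1 - q) : ℝ) * θ * bernoulliChar q θ
      = (q * (1 - q) : ℝ) * Complex.I * Complex.exp ((θ * (-q) : ℝ) * Complex.I)
        * ((Complex.exp (θ * Complex.I) - 1 - θ * Complex.I)
          - (θ * q : ℝ) * Complex.I * (Complex.exp (θ * Complex.I) - 1)) := by
    rw [bernoulliChar_eq]
    generalize Complex.exp ((θ * (-q) : ℝ) * Complex.I) = A
    push_cast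
    linear_combination ((q * (1 - q) : ℂ) * θ * A
      * (1 + q * (Complex.exp (θ * Complex.I) - 1))) * Complex.I_sq
  rw [e, norm_mul, norm_mul, norm_mul, Complex.norm_exp_ofReal_mul_I, Complex.norm_I,
    Complex.norm_real, Real.norm_of_nonneg hv0, mul_one, mul_one]
  have h2 : ‖(Complex.exp (θ * Complex.I) - 1 - θ * Complex.I)
          - (θ * q : ℝ) * Complex.I * (Complex.exp (θ * Complex.I) - 1)‖ ≤ 2 * θ ^ 2 := by
    refine (norm_sub_le _ _).trans ?_
    have h3 := norm_exp_mul_I_sub_one_sub_le θ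
    have h4 := norm_exp_mul_I_sub_one_le θ
    rw [norm_mul, norm_mul, Complex.norm_I, mul_one, Complex.norm_real, norm_mul,
      Real.norm_of_nonneg h0, Real.norm_eq_abs]
    have h5 : |θ| * q * ‖Complex.exp (θ * Complex.I) - 1‖ ≤ |θ| * 1 * |θ| :=
      mul_le_mul (mul_le_mul_of_nonneg_left h1 (abs_nonneg _)) h4 (norm_nonneg _) (by positivity)
    have h6 : |θ| * 1 * |θ| = θ ^ 2 := by rw [mul_one, ← sq, sq_abs]
    linarith
  calc _ ≤ 1 / 4 * (2 * θ ^ 2) := mul_le_mul hv1 h2 (norm_nonneg _) (by norm_num)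
    _ ≤ θ ^ 2 := by nlinarith [sq_nonneg θ]

/-- The characteristic function of a centered binomial distribution whose variance is within `1` of
`s` nearly satisfies the differential equation of a Gaussian characteristic function. -/
theorem norm_deriv_bernoulliChar_pow_add_le {q θ s : ℝ} (h0 : 0 ≤ q) (h1 : q ≤ 1)
    (hθ : |θ| ≤ Real.pi) {m : ℕ} (hm : 1 ≤ m) (hs : |s - m * (q * (1 - q))| ≤ 1) :
    ‖(m : ℂ) * bernoulliChar q θ ^ (m - 1) * (Complex.I * (q * (1 - q) : ℝ)
      * (Complex.exp ((θ * (-q) : ℝ) * Complex.I) * (Complex.exp (θ * Complex.I) - 1)))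
      + s * θ * bernoulliChar q θ ^ m‖
      ≤ (m * θ ^ 2 + |θ|)
        * Real.exp (-(q * (1 - q) * (2 / Real.pi ^ 2) * θ ^ 2)) ^ (m - 1) := by
  obtain ⟨k, rfl⟩ : ∃ k, m = k + 1 := ⟨m - 1, by omega⟩
  rw [Nat.add_sub_cancel]
  have hu := norm_bernoulliChar_le h0 h1 hθ
  have hu1 : ‖bernoulliChar q θ‖ ≤ 1 := hu.trans (Real.exp_le_one_iff.2 (by
    have : 0 ≤ q * (1 - q) := mul_nonneg h0 (by linarith)
    have : 0 ≤ q * (1 - q) * (2 / Real.pi ^ 2) * θ ^ 2 := by positivity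
    linarith))
  have hd := norm_deriv_bernoulliChar_add_le θ h0 h1
  set D := Complex.I * (q * (1 - q) : ℝ)
      * (Complex.exp ((θ * (-q) : ℝ) * Complex.I) * (Complex.exp (θ * Complex.I) - 1)) with hD
  set u := bernoulliChar q θ with hu'
  -- One factor is split off the power: the single-trial errors give `mθ²`, and the variance
  -- mismatch, at most `1`, gives `|θ|`.
  have e : ((k + 1 : ℕ) : ℂ) * u ^ k * D + s * θ * u ^ (k + 1)
      = (((k + 1 : ℕ) : ℂ) * (D + (q * (1 - q) : ℝ) * θ * u)
        + ((s - (k + 1 : ℕ) * (q * (1 - q)) : ℝ) : ℂ) * θ * u) * u ^ k := by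
    push_cast
    ring
  rw [e, norm_mul, norm_pow]
  refine mul_le_mul ?_ (pow_le_pow_left₀ (norm_nonneg _) hu k) (by positivity) (by positivity)
  refine (norm_add_le _ _).trans (add_le_add ?_ ?_)
  · rw [norm_mul, Complex.norm_natCast]
    exact mul_le_mul_of_nonneg_left hd (Nat.cast_nonneg _)
  · rw [norm_mul, norm_mul, Complex.norm_real, Complex.norm_real, Real.norm_eq_abs,
      Real.norm_eq_abs]
    calc _ ≤ 1 * |θ| * 1 := mul_le_mul (mul_le_mul_of_nonneg_right hs (abs_nonneg _)) hu1
          (norm_nonneg _) (by positivity)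
      _ = _ := by ring

end CenteredBinomial

/-! ### The two laws on the lattice and the parameters of the binomial. -/

section ScanApproximation

variable (μ : Measure ℝ)

theorem ae_map_scanSum (r : ℕ) (a p : ℝ) (n : ℕ) :
    ∀ᵐ x ∂((Measure.infinitePi fun _ : ℕ => μ).map (scanSum r a p (Finset.Icc 1 n))),
      ∃ z ∈ Finset.Icc (0 : ℤ) n, x = (z : ℝ) + -(n * p) := by
  have hfin : MeasurableSet {x : ℝ | ∃ z ∈ Finset.Icc (0 : ℤ) n, x = (z : ℝ) + -(n * p)} := by
    have : {x : ℝ | ∃ z ∈ Finset.Icc (0 : ℤ) n, x = (z : ℝ) + -(n * p)}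
        = ⋃ z ∈ Finset.Icc (0 : ℤ) n, {(z : ℝ) + -(n * p)} := by
      ext x; simp
    rw [this]
    exact Finset.measurableSet_biUnion _ fun k _ => measurableSet_singleton _
  rw [ae_map_iff (measurable_scanSum r a p _).aemeasurable hfin]
  refine Filter.Eventually.of_forall fun x => ?_
  have hcount : ∀ A : Finset ℕ, ∃ k : ℕ, k ≤ A.card ∧ ∑ i ∈ A, lowScan r a i x = k := by
    intro A
    induction A using Finset.induction_on with
    | empty => exact ⟨0, by simp⟩
    | insert i A hi ih =>
      obtain ⟨k, hk, hk'⟩ := ih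
      rw [Finset.sum_insert hi, Finset.card_insert_of_notMem hi, hk']
      by_cases h : x ∈ {x | rScan (fun (j : ℕ) (x : ℕ → ℝ) => max (x j) 0) r i x ≤ a}
      · exact ⟨k + 1, by omega, by
          rw [lowScan, Set.indicator_of_mem h]; push_cast; ring⟩
      · exact ⟨k, by omega, by rw [lowScan, Set.indicator_of_notMem h, zero_add]⟩
  obtain ⟨k, hk, hk'⟩ := hcount (Finset.Icc 1 n)
  rw [Nat.card_Icc, Nat.add_sub_cancel] at hk
  refine ⟨k, Finset.mem_Icc.2 ⟨by omega, by omega⟩, ?_⟩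
  rw [scanSum, Finset.sum_sub_distrib, hk']
  simp
  ring

theorem ceil_eq_add_roundingError {s : ℝ} (hs : 1 < s) :
    ((⌈4 * s⌉₊ : ℕ) : ℝ) = 4 * s + roundingError s := by
  rw [natCast_ceil_eq_intCast_ceil (by linarith), roundingError, Int.fract, Int.floor_neg]
  push_cast
  ring

/-- This is the purpose of `t`: it makes the binomial mean congruent to `-b` modulo `1`, so the
centered binomial lives on `ℤ + b`. -/
theorem ceil_mul_half_sub_latticeParam (b : ℝ) {s : ℝ} (hs : 1 < s) :
    ((⌈4 * s⌉₊ : ℕ) : ℝ) * (1 / 2 - latticeParam b s)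
      = ⌊b + 2 * s + roundingError s / 2⌋ - b := by
  have hd : 0 ≤ roundingError s := Int.fract_nonneg _
  have h0 : 4 * s + roundingError s ≠ 0 := by linarith
  rw [ceil_eq_add_roundingError hs, latticeParam, mul_sub, mul_div_cancel₀ _ h0, Int.fract]
  ring

theorem ae_approxBinomial (b : ℝ) {s : ℝ} (hs : 1 < s) :
    ∀ᵐ x ∂(approxBinomial b hs), ∃ z ∈ Finset.Icc (-⌊b + 2 * s + roundingError s / 2⌋)
      (⌈4 * s⌉₊ - ⌊b + 2 * s + roundingError s / 2⌋), x = (z : ℝ) + b := by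
  unfold approxBinomial
  filter_upwards [ae_centeredBinomial ⌈4 * s⌉₊ ⟨1 / 2 - latticeParam b s,
    half_sub_latticeParam_mem b hs⟩] with x hx
  obtain ⟨k, hk, rfl⟩ := hx
  refine ⟨k - ⌊b + 2 * s + roundingError s / 2⌋, Finset.mem_Icc.2 ⟨by omega, by omega⟩, ?_⟩
  rw [ceil_mul_half_sub_latticeParam b hs]
  push_cast
  ring

/-- The variance of the approximating binomial distribution is close to `s`, and its success
probability is bounded away from `0` and `1`. -/
theorem latticeParam_variance_bounds (b : ℝ) {s : ℝ} (hs : 1 < s) :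
    3 / 16 ≤ (1 / 2 - latticeParam b s) * (1 - (1 / 2 - latticeParam b s)) ∧
      |s - (⌈4 * s⌉₊ : ℕ) * ((1 / 2 - latticeParam b s) * (1 - (1 / 2 - latticeParam b s)))| ≤ 1 := by
  have hd : 0 ≤ roundingError s := Int.fract_nonneg _
  have hd1 : roundingError s < 1 := Int.fract_lt_one _
  have hf0 := Int.fract_nonneg (b + 2 * s + roundingError s / 2)
  have hf1 := Int.fract_lt_one (b + 2 * s + roundingError s / 2)
  have hm := ceil_eq_add_roundingError hs
  set m : ℝ := ((⌈4 * s⌉₊ : ℕ) : ℝ) with hm'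
  have hm4 : 4 < m := by linarith
  set t := latticeParam b s with ht
  have ht' : t * m = Int.fract (b + 2 * s + roundingError s / 2) := by
    rw [ht, latticeParam, ← hm, div_mul_cancel₀ _ (by linarith)]
  have ht0 : 0 ≤ t := by
    by_contra h
    push Not at h
    nlinarith
  have ht4 : t ≤ 1 / 4 := by
    by_contra h
    push Not at h
    nlinarith
  refine ⟨by nlinarith, ?_⟩
  -- The binomial variance is `m/4 - mt²` with `m = 4s + δ`. Both corrections are small, since `tm`
  -- is a fractional part, `t ≤ 1/4` and `δ < 1`.
  have e : s - m * ((1 / 2 - t) * (1 - (1 / 2 - t))) = t * (t * m) - roundingError s / 4 := by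
    linear_combination (-1 / 4 : ℝ) * hm
  rw [e, ht', abs_le]
  constructor <;> nlinarith

/-- The binomial decays at a rate proportional to `s`, hence to `n`, so its error has the same shape
as that of the scan count; only the rate drops from `c` to `c/5`. -/
theorem norm_deriv_trigSum_approxBinomial_le {b s c n : ℝ} (hs : 1 < s) (hcs : 2 * (c * n) ≤ s) {S : Finset ℤ}
    (hS : ∀ᵐ x ∂(approxBinomial b hs), ∃ z ∈ S, x = (z : ℝ) + b) {θ : ℝ} (hθ : |θ| ≤ Real.pi) :
    ‖Complex.I * trigSum S (fun z => (z + b) * (approxBinomial b hs).real {(z : ℝ) + b}) b θ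
      + s * θ * trigSum S (fun z => (approxBinomial b hs).real {(z : ℝ) + b}) b θ‖
      ≤ (5 * s * θ ^ 2 + |θ|) * Real.exp (-(c / 5 * n * θ ^ 2)) := by
  have : IsProbabilityMeasure (approxBinomial b hs) :=
    isProbabilityMeasure_centeredBinomial _ _
  obtain ⟨hv, hsv⟩ := latticeParam_variance_bounds b hs
  obtain ⟨hq0, hq1⟩ := half_sub_latticeParam_mem b hs
  have hd : 0 ≤ roundingError s := Int.fract_nonneg _
  have hd1 : roundingError s < 1 := Int.fract_lt_one _
  have hm := ceil_eq_add_roundingError hs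
  have htrig : trigSum S (fun z => (approxBinomial b hs).real {(z : ℝ) + b}) b
      = fun θ => bernoulliChar (1 / 2 - latticeParam b s) θ ^ ⌈4 * s⌉₊ := by
    funext θ
    rw [trigSum_eq_integral hS]
    exact integral_exp_centeredBinomial _ _ θ
  have hder := (hasDerivAt_trigSum S (fun z => (approxBinomial b hs).real {(z : ℝ) + b}) b θ).unique
    (htrig ▸ (hasDerivAt_bernoulliChar (1 / 2 - latticeParam b s) θ).fun_pow ⌈4 * s⌉₊)
  rw [hder, htrig]
  set q := 1 / 2 - latticeParam b s with hq
  set m := ⌈4 * s⌉₊ with hm'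
  have hm1 : 1 ≤ m := by
    have : (1 : ℝ) ≤ m := by linarith
    exact_mod_cast this
  refine (norm_deriv_bernoulliChar_pow_add_le hq0 hq1 hθ hm1 hsv).trans ?_
  refine mul_le_mul ?_ ?_ (by positivity) (by positivity)
  · have : (m : ℝ) ≤ 5 * s := by linarith
    have := mul_le_mul_of_nonneg_right this (sq_nonneg θ)
    linarith
  · rw [← Real.exp_nat_mul, Nat.cast_sub hm1]
    refine Real.exp_le_exp.2 ?_
    have hm3 : 3 * s ≤ (m : ℝ) - 1 := by linarith
    have hπ : 1 / 5 ≤ 2 / Real.pi ^ 2 := by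
      rw [div_le_div_iff₀ (by norm_num) (by positivity)]
      nlinarith [Real.pi_lt_d2, Real.pi_pos]
    -- The fraction is chosen so that `3s · (3/16) · (8/45) = s/10`, which is at least `cn/5` by
    -- `2cn ≤ s`.
    have hπ' : 8 / 45 ≤ 2 / Real.pi ^ 2 := by linarith
    have h1 : c / 5 * n ≤ ((m : ℝ) - 1) * (q * (1 - q) * (2 / Real.pi ^ 2)) := by
      have h2 : 3 / 16 * (8 / 45) ≤ q * (1 - q) * (2 / Real.pi ^ 2) :=
        mul_le_mul hv hπ' (by norm_num) (by linarith)
      have h3 : 3 * s * (3 / 16 * (8 / 45)) ≤ ((m : ℝ) - 1) * (q * (1 - q) * (2 / Real.pi ^ 2)) :=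
        mul_le_mul hm3 h2 (by norm_num) (by linarith)
      linarith
    have h4 := mul_le_mul_of_nonneg_right h1 (sq_nonneg θ)
    push_cast
    linarith

end ScanApproximation

/-! ### The approximation on the canonical product space. -/

section ScanApproximation

variable (μ : Measure ℝ) [IsProbabilityMeasure μ]

/-- The approximation of the centered scan count of a sequence of independent variables on the
canonical product space. -/
theorem exists_scanSum_bounds {r : ℕ} (hr : 1 ≤ r) {a : ℝ} (ha : 0 < a)
    (hlow : ∀ x, 0 < x → 0 < μ.real (Set.Iic x)) (hhigh : 0 < μ.real (Set.Ioi a)) :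
    ∃ C : ℝ, ∀ (n : ℕ) (p s : ℝ) (hs : 1 < s),
      ∫ x, lowScan r a 1 x ∂(Measure.infinitePi fun _ : ℕ => μ) = p →
      ∫ x, scanSum r a p (Finset.Icc 1 n) x ^ 2 ∂(Measure.infinitePi fun _ : ℕ => μ) = s →
      dTV ((Measure.infinitePi fun _ : ℕ => μ).map (scanSum r a p (Finset.Icc 1 n)))
          (approxBinomial (-(n * p)) hs) ≤ C / Real.sqrt n ∧
        dLoc ((Measure.infinitePi fun _ : ℕ => μ).map (scanSum r a p (Finset.Icc 1 n)))
          (approxBinomial (-(n * p)) hs) ≤ C / n := by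
  set c := decayRate μ r a with hc'
  have hc : 0 < c := decayRate_pos μ hr ha hlow hhigh
  -- The terms account for the expansion error of the scan count, the binomial error `5sθ²` with `s
  -- ≤ 2rn`, and the binomial term `|θ|`. This also gives `s ≤ Kn`.
  set K : ℝ := 24 * r ^ 2 * Real.exp 14 + 10 * r + 1 with hK'
  have hK : 0 ≤ K := by positivity
  obtain ⟨C, hC0, hC⟩ := exists_coeff_bounds (c := c / 5) (by positivity) hK
  refine ⟨C, fun n p s hs hp hsv => ?_⟩
  have hp' : ∀ i, ∫ x, lowScan r a i x ∂(Measure.infinitePi fun _ : ℕ => μ) = p :=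
    fun i => (integral_lowScan_eq μ r a i).trans hp
  obtain ⟨hp0, hp1⟩ : 0 ≤ p ∧ p ≤ 1 := hp ▸ integral_lowScan_mem μ r a 1
  have hsn : s ≤ 2 * r * n := hsv ▸ integral_scanSum_sq_le μ hp0 hp1 hp' n
  have hcs : 2 * (c * n) ≤ s := hsv ▸ two_mul_decayRate_le μ hr ha hp0 hp1 hc n
  -- For `n = 0` the bound `s ≤ 2rn` would contradict `s > 1`.
  have hn1 : (1 : ℝ) ≤ n := by
    rcases Nat.eq_zero_or_pos n with h | h
    · subst h
      simp only [Nat.cast_zero, mul_zero] at hsn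
      linarith
    · exact_mod_cast h
  have hn0 : (0 : ℝ) < n := by linarith
  set W := scanSum r a p (Finset.Icc 1 n) with hW
  have hWm : Measurable W := measurable_scanSum _ _ _ _
  set b : ℝ := -(n * p) with hb
  set P := (Measure.infinitePi fun _ : ℕ => μ).map W with hP
  have : IsProbabilityMeasure P := Measure.isProbabilityMeasure_map hWm.aemeasurable
  set Q := approxBinomial b hs with hQ
  have : IsProbabilityMeasure Q := isProbabilityMeasure_centeredBinomial _ _
  set S : Finset ℤ := Finset.Icc (0 : ℤ) n ∪ Finset.Icc (-⌊b + 2 * s + roundingError s / 2⌋)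
      (⌈4 * s⌉₊ - ⌊b + 2 * s + roundingError s / 2⌋) with hS
  have hPS : ∀ᵐ x ∂P, ∃ z ∈ S, x = (z : ℝ) + b := by
    filter_upwards [ae_map_scanSum μ r a p n] with x hx
    obtain ⟨z, hz, hx⟩ := hx
    exact ⟨z, Finset.mem_union_left _ hz, hx⟩
  have hQS : ∀ᵐ x ∂Q, ∃ z ∈ S, x = (z : ℝ) + b := by
    filter_upwards [ae_approxBinomial b hs] with x hx
    obtain ⟨z, hz, hx⟩ := hx
    exact ⟨z, Finset.mem_union_right _ hz, hx⟩
  have hmain := hC S (fun z => P.real {(z : ℝ) + b} - Q.real {(z : ℝ) + b}) b n s hn1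
    (by nlinarith) ?_ ?_ ?_
  · exact ⟨(dTV_le_sum_lattice hPS hQS).trans hmain.2,
      dLoc_le_of_lattice hPS hQS (by positivity) hmain.1⟩
  · refine hsn.trans (mul_le_mul_of_nonneg_right ?_ hn0.le)
    have : (0 : ℝ) ≤ 24 * r ^ 2 * Real.exp 14 := by positivity
    have : (0 : ℝ) ≤ r := Nat.cast_nonneg r
    linarith
  · rw [Finset.sum_sub_distrib, sum_lattice_eq_one hPS, sum_lattice_eq_one hQS, sub_self]
  · intro θ hθ
    have hB := norm_deriv_trigSum_approxBinomial_le hs hcs hQS hθ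
    have hA := norm_integral_scanSum_mul_exp_sub_le μ hr ha hθ hp0 hp1 hp' n
    rw [hsv] at hA
    have e1 : trigSum S (fun z => (z + b) * (P.real {(z : ℝ) + b} - Q.real {(z : ℝ) + b})) b θ
        = trigSum S (fun z => (z + b) * P.real {(z : ℝ) + b}) b θ
          - trigSum S (fun z => (z + b) * Q.real {(z : ℝ) + b}) b θ := by
      rw [← trigSum_sub]
      simp only [mul_sub]
    rw [e1, trigSum_sub]
    have e2 : trigSum S (fun z => P.real {(z : ℝ) + b}) b θ
        = ∫ x, Complex.exp ((θ * W x : ℝ) * Complex.I) ∂(Measure.infinitePi fun _ : ℕ => μ) := by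
      rw [trigSum_eq_integral hPS, hP, integral_map hWm.aemeasurable (by fun_prop)]
    have e3 : trigSum S (fun z => (z + b) * P.real {(z : ℝ) + b}) b θ
        = ∫ x, (W x : ℂ) * Complex.exp ((θ * W x : ℝ) * Complex.I)
          ∂(Measure.infinitePi fun _ : ℕ => μ) := by
      rw [trigSum_mul_eq_integral hPS, hP, integral_map hWm.aemeasurable (by fun_prop)]
    rw [← e2, ← e3] at hA
    set A₀ := trigSum S (fun z => P.real {(z : ℝ) + b}) b θ
    set A₁ := trigSum S (fun z => (z + b) * P.real {(z : ℝ) + b}) b θ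
    set B₀ := trigSum S (fun z => Q.real {(z : ℝ) + b}) b θ
    set B₁ := trigSum S (fun z => (z + b) * Q.real {(z : ℝ) + b}) b θ
    have e4 : Complex.I * (A₁ - B₁) + s * θ * (A₀ - B₀)
        = Complex.I * (A₁ - θ * Complex.I * s * A₀) - (Complex.I * B₁ + s * θ * B₀) := by
      linear_combination (θ * s * A₀) * Complex.I_sq
    rw [e4]
    refine (norm_sub_le _ _).trans ?_
    rw [norm_mul, Complex.norm_I, one_mul]
    refine (add_le_add hA hB).trans ?_
    have h3 : Real.exp (-(c * n * θ ^ 2)) ≤ Real.exp (-(c / 5 * n * θ ^ 2)) := by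
      refine Real.exp_le_exp.2 ?_
      have : 0 ≤ c * n * θ ^ 2 := by positivity
      linarith
    set e := Real.exp (-(c / 5 * n * θ ^ 2))
    have he0 : 0 ≤ e := Real.exp_nonneg _
    have h4 : 24 * r ^ 2 * Real.exp 14 * n * θ ^ 2 * Real.exp (-(c * n * θ ^ 2))
        ≤ 24 * r ^ 2 * Real.exp 14 * n * θ ^ 2 * e :=
      mul_le_mul_of_nonneg_left h3 (by positivity)
    have h5 : 5 * s * θ ^ 2 ≤ 5 * (2 * r * n) * θ ^ 2 := by
      have := sq_nonneg θ
      nlinarith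
    have h6 : 24 * r ^ 2 * Real.exp 14 * n * θ ^ 2 + (5 * s * θ ^ 2 + |θ|)
        ≤ K * (n * θ ^ 2 + |θ|) := by
      have h7 : (0 : ℝ) ≤ (24 * r ^ 2 * Real.exp 14 + 10 * r) * |θ| := by positivity
      have h8 : (0 : ℝ) ≤ n * θ ^ 2 := by positivity
      rw [hK']
      nlinarith
    calc _ ≤ (24 * r ^ 2 * Real.exp 14 * n * θ ^ 2 + (5 * s * θ ^ 2 + |θ|)) * e := by linarith
      _ ≤ _ := mul_le_mul_of_nonneg_right h6 he0

end ScanApproximation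

/-! ### From an arbitrary probability space to the product space. -/

section Transfer

/-- A function of finitely many of the coordinates has the same law under independent variables
with distribution `μ` as under the product measure. -/
theorem map_comp_eq_map_infinitePi {μ : Measure ℝ} [IsProbabilityMeasure μ] {Ω : Type*}
    [MeasurableSpace Ω] {P : Measure Ω} {X : ℕ → Ω → ℝ} {J : Finset ℕ}
    (hX : ∀ j ∈ J, Measurable (X j)) (hlaw : ∀ j ∈ J, P.map (X j) = μ)
    (hind : iIndepFun (fun j : J => X j) P) {F : (ℕ → ℝ) → ℝ} (hF : Measurable F)
    (hFJ : DependsOn F J) :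
    (Measurable fun ω => F fun j => X j ω) ∧
      P.map (fun ω => F fun j => X j ω) = (Measure.infinitePi fun _ : ℕ => μ).map F := by
  -- The coordinates outside `J` get an arbitrary default value, which `F` does not see.
  set ext : (J → ℝ) → ℕ → ℝ := fun z i => if h : i ∈ J then z ⟨i, h⟩ else 0 with hext
  have hextm : Measurable ext := by
    refine measurable_pi_iff.2 fun i => ?_
    by_cases h : i ∈ J
    · simp only [hext, h, dite_true]; exact measurable_pi_apply _
    · simp only [hext, h, dite_false]; exact measurable_const
  have h1 : (fun ω => F fun j => X j ω) = (F ∘ ext) ∘ fun ω (j : J) => X j ω := by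
    funext ω
    refine hFJ fun i hi => ?_
    have : i ∈ J := hi
    simp [hext, this]
  have h2 : F = (F ∘ ext) ∘ J.restrict := by
    funext x
    refine hFJ fun i hi => ?_
    have : i ∈ J := hi
    simp [hext, this]
  have hY : Measurable fun ω (j : J) => X j ω := measurable_pi_iff.2 fun j => hX j j.2
  have hFe : Measurable (F ∘ ext) := hF.comp hextm
  refine ⟨h1 ▸ hFe.comp hY, ?_⟩
  conv_rhs => rw [h2]
  have h3 : P.map (fun ω (j : J) => X j ω) = Measure.pi fun _ : J => μ := by
    have := iIndepFun.map_fun_eq_pi_map (fun j : J => (hX j j.2).aemeasurable) hind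
    rw [this]
    congr 1
    funext j
    exact hlaw j j.2
  rw [h1, ← Measure.map_map hFe hY, ← Measure.map_map hFe (Finset.measurable_restrict J),
    Measure.infinitePi_map_restrict, h3]

end Transfer

/-- Strict monotonicity of the distribution function enters only through the positive masses of
`(-∞, x]` for `x > 0` and of `(a, ∞)`. These make the decay rate positive; the rest is transfer to
the product space. -/
theorem theorem4p1 (μ : Measure ℝ) [IsProbabilityMeasure μ]
    (hcont : Continuous (cdf μ)) (hzero : cdf μ 0 = 0)
    (hmono : ∀ x y : ℝ, 0 ≤ x → x < y → cdf μ x < cdf μ y)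
    (r : ℕ) (hr : 1 ≤ r) (a : ℝ) (ha : 0 < a) :
    ∃ C₁ C₂ : ℝ, ∀ (n : ℕ) (Ω : Type*) [MeasurableSpace Ω] (P : Measure Ω) [IsProbabilityMeasure P]
      (X : ℕ → Ω → ℝ),
      (∀ j ∈ Finset.Icc 1 (n + r - 1), Measurable (X j)) →
      (∀ j ∈ Finset.Icc 1 (n + r - 1), P.map (X j) = μ) →
      iIndepFun (fun j : Finset.Icc 1 (n + r - 1) => X j) P →
      ∀ hσ : 1 < variance (scanCount X r n a) P,
        dTV (centeredScanLaw P X r n a)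
            (approxBinomial (-(n * P.real {ω | rScan X r 1 ω ≤ a})) hσ)
          ≤ C₁ * (n : ℝ) ^ (-(1 / 2 : ℝ)) ∧
        dLoc (centeredScanLaw P X r n a)
            (approxBinomial (-(n * P.real {ω | rScan X r 1 ω ≤ a})) hσ)
          ≤ C₂ * (n : ℝ) ^ (-(2 / 2 : ℝ)) := by
  have hlow : ∀ x, 0 < x → 0 < μ.real (Set.Iic x) := by
    intro x hx
    have := hmono 0 x le_rfl hx
    rwa [hzero, cdf_eq_real] at this
  have hhigh : 0 < μ.real (Set.Ioi a) := by
    have h1 := hmono a (a + 1) ha.le (by linarith)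
    have h2 := cdf_le_one μ (a + 1)
    have h3 := probReal_compl_eq_one_sub (μ := μ) (measurableSet_Iic (a := a))
    rw [Set.compl_Iic, ← cdf_eq_real] at h3
    linarith
  obtain ⟨C, hC⟩ := exists_scanSum_bounds μ hr ha hlow hhigh
  refine ⟨C, C, fun n Ω _ P _ X hX hlaw hind hσ => ?_⟩
  set J := Finset.Icc 1 (n + r - 1) with hJ
  have hn : 1 ≤ n := by
    by_contra h
    obtain rfl : n = 0 := by omega
    have : scanCount X r 0 a = fun _ => 0 := by
      funext ω; simp [scanCount]
    have hv : variance (fun _ : Ω => (0 : ℝ)) P = 0 := variance_zero P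
    rw [this, hv] at hσ
    linarith
  have hpos : ∀ᵐ ω ∂P, ∀ j ∈ J, 0 ≤ X j ω := by
    rw [Filter.eventually_all_finset]
    intro j hj
    have h0 : μ (Set.Iic 0) = 0 := by
      rw [cdf_eq_real, measureReal_eq_zero_iff] at hzero
      exact hzero
    rw [← hlaw j hj, Measure.map_apply (hX j hj) measurableSet_Iic] at h0
    refine measure_mono_null (fun ω hω => ?_) h0
    simp only [Set.mem_compl_iff, Set.mem_ofPred_eq, not_le] at hω
    exact hω.le
  -- `F(0) = 0` makes the variables almost surely nonnegative, so passing to positive parts changes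
  -- nothing.
  have hscan : ∀ᵐ ω ∂P, ∀ k ∈ Finset.Icc 1 n,
      rScan X r k ω = rScan (fun (j : ℕ) (x : ℕ → ℝ) => max (x j) 0) r k fun j => X j ω := by
    filter_upwards [hpos] with ω hω k hk
    refine Finset.sum_congr rfl fun i hi => ?_
    rw [Finset.mem_Icc] at hk
    rw [Finset.mem_range] at hi
    exact (max_eq_left (hω (k + i) (Finset.mem_Icc.2 ⟨by omega, by omega⟩))).symm
  set p := P.real {ω | rScan X r 1 ω ≤ a} with hp
  have hdep : ∀ k ∈ Finset.Icc 1 n, DependsOn (lowScan r a k) J := by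
    intro k hk x y h
    refine dependsOn_lowScan r a k fun j hj => h j ?_
    rw [Finset.mem_Icc] at hk
    simp only [Finset.coe_Ico, Set.mem_Ico] at hj
    simp only [hJ, Finset.coe_Icc, Set.mem_Icc]
    omega
  have hpI : ∫ x, lowScan r a 1 x ∂(Measure.infinitePi fun _ : ℕ => μ) = p := by
    obtain ⟨hm, hmap⟩ := map_comp_eq_map_infinitePi hX hlaw hind (measurable_lowScan r a 1)
      (hdep 1 (Finset.mem_Icc.2 ⟨le_rfl, hn⟩))
    have h1 : ∫ x, lowScan r a 1 x ∂(Measure.infinitePi fun _ : ℕ => μ)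
        = ∫ ω, lowScan r a 1 (fun j => X j ω) ∂P := by
      have h2 := integral_map hm.aemeasurable (μ := P) (f := fun y : ℝ => y) (by fun_prop)
      have h3 := integral_map (measurable_lowScan r a 1).aemeasurable
        (μ := Measure.infinitePi fun _ : ℕ => μ) (f := fun y : ℝ => y) (by fun_prop)
      rw [← h2, hmap, h3]
    have hset : MeasurableSet {ω | rScan (fun (j : ℕ) (x : ℕ → ℝ) => max (x j) 0) r 1
        (fun j => X j ω) ≤ a} := by
      have : {ω | rScan (fun (j : ℕ) (x : ℕ → ℝ) => max (x j) 0) r 1 (fun j => X j ω) ≤ a}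
          = (fun ω => lowScan r a 1 fun j => X j ω) ⁻¹' {1} := by
        ext ω
        simp [lowScan, Set.indicator_apply]
      rw [this]
      exact hm (measurableSet_singleton 1)
    rw [h1, hp]
    have h4 : (fun ω => lowScan r a 1 fun j => X j ω) = Set.indicator {ω | rScan
        (fun (j : ℕ) (x : ℕ → ℝ) => max (x j) 0) r 1 (fun j => X j ω) ≤ a} fun _ => (1 : ℝ) := by
      funext ω
      simp [lowScan, Set.indicator_apply]
    rw [h4, integral_indicator_const _ hset, smul_eq_mul, mul_one]
    refine measureReal_congr ?_
    filter_upwards [hscan] with ω hω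
    have := hω 1 (Finset.mem_Icc.2 ⟨le_rfl, hn⟩)
    exact propext (by
      change rScan _ r 1 _ ≤ a ↔ rScan X r 1 ω ≤ a
      rw [this])
  obtain ⟨hWm, hWmap⟩ := map_comp_eq_map_infinitePi hX hlaw hind
    (measurable_scanSum r a p (Finset.Icc 1 n)) (fun x y h => Finset.sum_congr rfl fun k hk => by
      rw [hdep k hk h])
  have hae : (fun ω => scanCount X r n a ω - n * p)
      =ᵐ[P] fun ω => scanSum r a p (Finset.Icc 1 n) fun j => X j ω := by
    filter_upwards [hscan] with ω hω
    rw [scanSum, Finset.sum_sub_distrib, scanCount]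
    congr 1
    · refine Finset.sum_congr rfl fun k hk => ?_
      simp [lowScan, Set.indicator_apply, hω k hk]
    · simp
  have hlawW : centeredScanLaw P X r n a
      = (Measure.infinitePi fun _ : ℕ => μ).map (scanSum r a p (Finset.Icc 1 n)) := by
    rw [← hWmap]
    exact Measure.map_congr hae
  have hmean : ∫ x, scanSum r a p (Finset.Icc 1 n) x ∂(Measure.infinitePi fun _ : ℕ => μ) = 0 := by
    have hint : ∀ k, Integrable (lowScan r a k) (Measure.infinitePi fun _ : ℕ => μ) := fun k =>
      integrable_infinitePi_of_bound μ (measurable_lowScan r a k).aestronglyMeasurable (M := 1)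
        fun x => by
          rw [Real.norm_of_nonneg (lowScan_nonneg _ _ _ _)]; exact lowScan_le_one _ _ _ _
    simp only [scanSum]
    have hint' : ∀ k, Integrable (fun x => lowScan r a k x - p)
        (Measure.infinitePi fun _ : ℕ => μ) := fun k => (hint k).sub (integrable_const _)
    rw [integral_finsetSum _ fun k _ => hint' k]
    refine Finset.sum_eq_zero fun k _ => ?_
    rw [integral_sub (hint k) (integrable_const _), integral_lowScan_eq, hpI]
    simp
  have hvar : ∫ x, scanSum r a p (Finset.Icc 1 n) x ^ 2 ∂(Measure.infinitePi fun _ : ℕ => μ)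
      = variance (scanCount X r n a) P := by
    -- Only almost everywhere measurability is derived: the count agrees almost surely with a
    -- measurable function of the coordinates in `J`.
    have hcount : AEMeasurable (scanCount X r n a) P := by
      have : AEMeasurable (fun ω => scanCount X r n a ω - n * p + n * p) P :=
        (hWm.aemeasurable.congr hae.symm).add_const _
      simpa using this
    have h1 : variance (scanCount X r n a) P
        = variance (fun ω => scanCount X r n a ω - n * p) P :=
      (variance_sub_const hcount.aestronglyMeasurable _).symm
    have h2 : variance (fun ω => scanSum r a p (Finset.Icc 1 n) fun j => X j ω) P
        = variance (scanSum r a p (Finset.Icc 1 n)) (Measure.infinitePi fun _ : ℕ => μ) := by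
      have h3 := variance_map (X := id) (μ := P) aemeasurable_id hWm.aemeasurable
      have h4 := variance_map (X := id) (μ := Measure.infinitePi fun _ : ℕ => μ) aemeasurable_id
        (measurable_scanSum r a p (Finset.Icc 1 n)).aemeasurable
      rw [hWmap, h4] at h3
      exact h3.symm
    rw [h1, variance_congr hae, h2, variance_of_integral_eq_zero
      (measurable_scanSum r a p (Finset.Icc 1 n)).aemeasurable hmean]
  have hfinal := hC n p _ hσ hpI hvar
  rw [hlawW]
  refine ⟨hfinal.1.trans (le_of_eq ?_), hfinal.2.trans (le_of_eq ?_)⟩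
  · rw [Real.rpow_neg (Nat.cast_nonneg n), ← Real.sqrt_eq_rpow, div_eq_mul_inv]
  · rw [div_self two_ne_zero, Real.rpow_neg_one, div_eq_mul_inv]
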